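/- Work in the two-sorted language $L_2$ of second-order arithmetic. Let $\mathsf{ACA}_0$ be the theory with the usual basic axioms for $0,1,+,\cdot,<$, the induction axiom for sets, and comprehension for arithmetical formulas (with parameters), and let $\mathsf{ATR}_0$ be $\mathsf{ACA}_0$ plus arithmetical transfinite recursion along arbitrary well orders. We use the following notions inside $\mathsf{ACA}_0$. A *coded $\omega$-model* is given by a set $W$; its numbers are all numbers and its sets are the sections $(W)_n=\{m\mid (m,n)\in W\}$. We write $Z\in\mathcal M$ if $Z$ is one of the sets of $\mathcal M$; for coded $\omega$-models, $\mathcal M_0\in\mathcal M_1$ means that the code of $\mathcal M_0$ is one of the sets of $\mathcal M_1$. A coded $\omega$-model $\mathcal M$ is a *coded $\beta$-model* if every $\Pi^1_1$-formula with number parameters and with set parameters from $\mathcal M$ is true if and only if it is satisfied in $\mathcal M$. For a coded $\omega$-model $\mathcal M\ni X$, we write $\mathcal M\vDash\Pi^1_1\text{-}\mathsf{CA}_0(X)$ if $\mathcal M$ contains the set $\{x\mid\mathcal M\vDash\varphi(x,X)\}$ for every $\Pi^1_1$-formula $\varphi$ with no set parameters other than $X$ (number parameters are allowed). The principle $\Pi^1_1\text{-}\mathsf{CA}^\Gamma$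 of *pseudo $\Pi^1_1$-comprehension* asserts that every set $X\subseteq\mathbb N$ belongs to some coded $\omega$-model $\mathcal M$ with $\mathcal M\vDash\mathsf{ATR}_0$ and $\mathcal M\vDash\Pi^1_1\text{-}\mathsf{CA}_0(X)$. The principle $\beta^1_0\mathsf{RFN}(1;\mathsf{ATR})$ asserts that for every set $X\subseteq\mathbb N$ there are coded $\omega$-models $\mathcal M_0\in\mathcal M_1$ such that $$\mathcal M_1\vDash\mathsf{ATR}_0+\text{``}\mathcal M_0\text{ is a coded }\beta\text{-model with }X\in\mathcal M_0\text{''}.$$ **Proposition.** Over $\mathsf{ACA}_0$, the principles $\Pi^1_1\text{-}\mathsf{CA}^\Gamma$ and $\beta^1_0\mathsf{RFN}(1;\mathsf{ATR})$ are equivalent. That is, they are equivalent in every (possibly nonstandard) $L_2$-structure that satisfies $\mathsf{ACA}_0$. -/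

import Mathlib

/-! # Second-order arithmetic: language, structures, `ACA₀`, `ATR₀`, coded models -/

namespace SecondOrderArith

universe u

/-- Number terms of the language `L₂`; number variables are indexed by natural numbers. -/
inductive NumTerm : Type
  | var (x : ℕ)
  | zero
  | one
  | add (s t : NumTerm)
  | mul (s t : NumTerm)

/-- Formulas of the two-sorted language `L₂`. Number variables and set variables are each indexed
by natural numbers; the remaining connectives and the existential quantifiers are definable. -/
inductive Formula : Type
  | eq (s t : NumTerm)
  | lt (s t : NumTerm)
  | mem (t : NumTerm) (X : ℕ)
  | not (φ : Formula)
  | and (φ ψ : Formula)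
  | allNum (x : ℕ) (φ : Formula)
  | allSet (X : ℕ) (φ : Formula)

/-- A formula is arithmetical if it contains no set quantifiers
(free number and set variables, i.e. parameters, are allowed). -/
def Formula.IsArithmetical : Formula → Prop
  | .eq _ _ => True
  | .lt _ _ => True
  | .mem _ _ => True
  | .not φ => φ.IsArithmetical
  | .and φ ψ => φ.IsArithmetical ∧ ψ.IsArithmetical
  | .allNum _ φ => φ.IsArithmetical
  | .allSet _ _ => False

/-- `Π¹₁`-formulas: one universal set quantifier in front of an arithmetical formula. -/
def Formula.IsPi11 (φ : Formula) : Prop :=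
  ∃ (Y : ℕ) (θ : Formula), θ.IsArithmetical ∧ φ = .allSet Y θ

/-- An `L₂`-structure: a first-order part (possibly nonstandard) together with a nonempty
collection of subsets of the first-order part, over which the set variables range. -/
structure Model : Type (u + 1) where
  Num : Type u
  zero : Num
  one : Num
  add : Num → Num → Num
  mul : Num → Num → Num
  lt : Num → Num → Prop
  sets : Set (Set Num)
  sets_nonempty : sets.Nonempty

namespace Model

/-- The value of a number term under an assignment of the number variables. -/
def eval (M : Model.{u}) (ν : ℕ → M.Num) : NumTerm → M.Num
  | .var x => ν x
  | .zero => M.zero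
  | .one => M.one
  | .add s t => M.add (M.eval ν s) (M.eval ν t)
  | .mul s t => M.mul (M.eval ν s) (M.eval ν t)

/-- Tarskian satisfaction `M ⊨ φ[ν, σ]`, the set quantifiers ranging over `M.sets`. -/
def Sat (M : Model.{u}) : (ℕ → M.Num) → (ℕ → Set M.Num) → Formula → Prop
  | ν, _, .eq s t => M.eval ν s = M.eval ν t
  | ν, _, .lt s t => M.lt (M.eval ν s) (M.eval ν t)
  | ν, σ, .mem t X => M.eval ν t ∈ σ X
  | ν, σ, .not φ => ¬ M.Sat ν σ φ
  | ν, σ, .and φ ψ => M.Sat ν σ φ ∧ M.Sat ν σ ψ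
  | ν, σ, .allNum x φ => ∀ a : M.Num, M.Sat (Function.update ν x a) σ φ
  | ν, σ, .allSet X φ => ∀ A ∈ M.sets, M.Sat ν (Function.update σ X A) φ

/-- `M ⊨ ACA₀`: the basic axioms, the induction axiom (for sets) and comprehension for
arithmetical formulas with arbitrary number and set parameters. -/
structure ModelsACA₀ (M : Model.{u}) : Prop where
  succ_ne_zero : ∀ n, M.add n M.one ≠ M.zero
  succ_inj : ∀ m n, M.add m M.one = M.add n M.one → m = n
  add_zero : ∀ m, M.add m M.zero = m
  add_succ : ∀ m n, M.add m (M.add n M.one) = M.add (M.add m n) M.one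
  mul_zero : ∀ m, M.mul m M.zero = M.zero
  mul_succ : ∀ m n, M.mul m (M.add n M.one) = M.add (M.mul m n) m
  not_lt_zero : ∀ m, ¬ M.lt m M.zero
  lt_succ : ∀ m n, M.lt m (M.add n M.one) ↔ M.lt m n ∨ m = n
  induction : ∀ X ∈ M.sets, M.zero ∈ X → (∀ n ∈ X, M.add n M.one ∈ X) → ∀ n, n ∈ X
  arithmetical_comprehension : ∀ (φ : Formula), φ.IsArithmetical →
    ∀ (x : ℕ) (ν : ℕ → M.Num) (σ : ℕ → Set M.Num), (∀ i, σ i ∈ M.sets) →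
      {a | M.Sat (Function.update ν x a) σ φ} ∈ M.sets

/-- The pairing map `(i, j) = (i + j)² + i`. -/
def pair (M : Model.{u}) (i j : M.Num) : M.Num :=
  M.add (M.mul (M.add i j) (M.add i j)) i

/-- `i ≤_X j`, where `X` is viewed as a set of pairs. -/
def Le (M : Model.{u}) (X : Set M.Num) (i j : M.Num) : Prop := M.pair i j ∈ X

/-- `i <_X j`. -/
def Lt (M : Model.{u}) (X : Set M.Num) (i j : M.Num) : Prop := M.Le X i j ∧ ¬ M.Le X j i

/-- The field `{i | i ≤_X i}` of the relation coded by `X`. -/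
def field (M : Model.{u}) (X : Set M.Num) : Set M.Num := {i | M.Le X i i}

/-- `X` codes a (reflexive) linear order on its field. -/
structure IsLO (M : Model.{u}) (X : Set M.Num) : Prop where
  refl : ∀ i j, M.Le X i j → i ∈ M.field X ∧ j ∈ M.field X
  trans : ∀ i j k, M.Le X i j → M.Le X j k → M.Le X i k
  antisymm : ∀ i j, M.Le X i j → M.Le X j i → i = j
  total : ∀ i ∈ M.field X, ∀ j ∈ M.field X, M.Le X i j ∨ M.Le X j i

/-- `f` is the graph of a function from numbers to numbers, as a set of pairs. -/
def IsFunction (M : Model.{u}) (f : Set M.Num) : Prop :=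
  (∀ p ∈ f, ∃ n m, p = M.pair n m) ∧ ∀ n, ∃! m, M.pair n m ∈ f

/-- `M ⊨ WO(X)`: `X` codes a linear order, and no function in `M` is an infinite descending
sequence in it. -/
def IsWO (M : Model.{u}) (X : Set M.Num) : Prop :=
  M.IsLO X ∧ ¬ ∃ f ∈ M.sets, M.IsFunction f ∧
    ∀ n a b, M.pair n a ∈ f → M.pair (M.add n M.one) b ∈ f → M.Lt X b a

/-- `Y^j = {(m, i) ∈ Y | i <_X j}`, the part of the hierarchy `Y` below stage `j`. -/
def below (M : Model.{u}) (X Y : Set M.Num) (j : M.Num) : Set M.Num :=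
  {p | ∃ m i, p = M.pair m i ∧ M.Lt X i j ∧ M.pair m i ∈ Y}

/-- `M ⊨ ATR₀`: in addition to `ACA₀`, every arithmetical operator `θ(n, Y)` (with parameters,
`n` and `Y` being the variables with indices `x` and `Z`) can be iterated along every well order
`X` of `M`, i.e. there is `Y` in `M` with `Y = {(n, j) | j ∈ field(X) ∧ θ(n, Y^j)}`. -/
structure ModelsATR₀ (M : Model.{u}) : Prop extends ModelsACA₀ M where
  arithmetical_transfinite_recursion : ∀ (θ : Formula), θ.IsArithmetical →
    ∀ (x Z : ℕ) (ν : ℕ → M.Num) (σ : ℕ → Set M.Num), (∀ i, σ i ∈ M.sets) →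
      ∀ X ∈ M.sets, M.IsWO X → ∃ Y ∈ M.sets,
        Y = {p | ∃ n j, p = M.pair n j ∧ j ∈ M.field X ∧
          M.Sat (Function.update ν x n) (Function.update σ Z (M.below X Y j)) θ}

/-- The `n`-th section `(W)_n = {m | (m, n) ∈ W}`. -/
def sec (M : Model.{u}) (W : Set M.Num) (n : M.Num) : Set M.Num := {m | M.pair m n ∈ W}

/-- The `ω`-model coded by `W`: the numbers are those of `M`, and the sets are the sections
of `W`. (From the viewpoint of `M`, this is a countable coded `ω`-model if `W ∈ M.sets`.) -/
def coded (M : Model.{u}) (W : Set M.Num) : Model.{u} where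
  Num := M.Num
  zero := M.zero
  one := M.one
  add := M.add
  mul := M.mul
  lt := M.lt
  sets := Set.range (M.sec W)
  sets_nonempty := ⟨M.sec W M.zero, M.zero, rfl⟩

/-- `M ⊨ Π¹₁-CA₀(X)`: `M` contains `{a | M ⊨ φ(a, X)}` for every `Π¹₁`-formula `φ` whose only set
parameter is `X`, i.e. every free set variable of `φ` is interpreted by `X`. Number parameters are
allowed. -/
def ModelsPi11CA (M : Model.{u}) (X : Set M.Num) : Prop :=
  ∀ (φ : Formula), φ.IsPi11 → ∀ (x : ℕ) (ν : ℕ → M.Num),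
    {a | M.Sat (Function.update ν x a) (fun _ => X) φ} ∈ M.sets

/-- `M ⊨ "W codes a β-model"`: `W` is a set of `M`, and the `ω`-model coded by `W` agrees
with `M` on the truth of all `Π¹₁`-formulas (equivalently, by taking negations, of all
`Σ¹₁`-formulas) with number parameters and with set parameters from the coded model. -/
def IsCodedBeta (M : Model.{u}) (W : Set M.Num) : Prop :=
  W ∈ M.sets ∧
    ∀ (φ : Formula), φ.IsPi11 →
      ∀ (ν : ℕ → M.Num) (σ : ℕ → Set M.Num), (∀ i, σ i ∈ (M.coded W).sets) →
        ((M.coded W).Sat ν σ φ ↔ M.Sat ν σ φ)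

/-- `M ⊨ Π¹₁-CA^Γ` (pseudo `Π¹₁`-comprehension): in `M`, every set `X` belongs to a coded
`ω`-model that satisfies `ATR₀` and `Π¹₁-CA₀(X)`. -/
def PseudoPi11CA (M : Model.{u}) : Prop :=
  ∀ X ∈ M.sets, ∃ W ∈ M.sets,
    X ∈ (M.coded W).sets ∧ (M.coded W).ModelsATR₀ ∧ (M.coded W).ModelsPi11CA X

/-- `M ⊨ β¹₀RFN(1; ATR)`: in `M`, for every set `X` there are coded `ω`-models `M₀ ∈ M₁`, with
codes `W₀` and `W₁`, such that `M₁ ⊨ ATR₀` and `M₁ ⊨ "M₀ ∋ X is a coded β-model"`. -/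
def PseudoBetaReflectionATR (M : Model.{u}) : Prop :=
  ∀ X ∈ M.sets, ∃ W₀ ∈ M.sets, ∃ W₁ ∈ M.sets,
    W₀ ∈ (M.coded W₁).sets ∧ (M.coded W₁).ModelsATR₀ ∧
      (M.coded W₁).IsCodedBeta W₀ ∧ X ∈ ((M.coded W₁).coded W₀).sets

end Model

end SecondOrderArith

/-! From reflection to comprehension: if `M₁` contains a coded β-model `M₀` with `X` in it, a
`Π¹₁`-formula about `X` has the same truth value in `M₁` and in `M₀`. In `M₀` its set quantifier is
a number quantifier over sections, so arithmetical comprehension in `M₁` yields the required set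
(`IsCodedBeta.modelsPi11CA`).

For the converse, a β-model is read off from a leftmost path. An arithmetical condition on a set is
turned into a finite program: a list of local relations between functions, whose solutions consist
of the set together with truth values of subformulas, least counterexamples serving as Skolem
functions (`exists_program`). A single function `G` carries, for every program code `n`, a flag at
position `(n, 0)` and a candidate solution at index `n`; the parameters of program `n` are slot-zero
functions at indices `j < n`. `G` is accepted if it solves each program whose flag is zero. This is
a closed condition relative to a set `S` that codes list membership and the table of local
relations, one of which describes `X`.

In a model of `ATR₀` and `Π¹₁-CA₀(S)`, the finite conditions that extend to an accepted function
form a set (`exists_extending_mem`), and recursion along the numbers produces the leftmost path `G`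
(`ModelsATR₀.exists_leftmost`), which is accepted by closedness (`accepts_of_restrictions`). Suppose
that program `n` has a solution in the model, relative to the earlier functions of `G`. Keep `G`
below index `n`, insert this solution with flag zero, and switch off all later flags. The result is
accepted and agrees with `G` before position `(n, 0)`, so leftmostness forces the flag of `G` to be
zero, and `G` solves the program as well (`Codes.holds_of_solvable`). Hence the slot-zero functions
of `G` describe a coded β-model containing `X` (`Codes.exists_isCodedBeta`).

Formulas are external objects, so the relevant programs have standard length even over nonstandard
numbers; only the numbers occurring in them may be nonstandard. -/

namespace SecondOrderArith

universe u

/-! ### Arithmetical definability with parameters, and semantic comprehension -/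

namespace Model

/-- `R Y ν` is uniformly arithmetically definable in the set variable `Y` and the stack `ν` of
number variables, with set parameters from `𝒮`. Definability is stable under renamings of the number variables and
of the parameters, which makes the class closed under the logical operations. -/
class Adef (N : Model.{u}) (𝒮 : Set (Set N.Num)) (R : Set N.Num → (ℕ → N.Num) → Prop) : Prop where
  out : ∃ τ : ℕ → Set N.Num, (∀ i, τ i ∈ 𝒮) ∧ ∀ ρ κ : ℕ → ℕ, (Set.range ρ)ᶜ.Infinite →
    ∃ θ : Formula, θ.IsArithmetical ∧ ∀ ν σ, (∀ i, σ (κ i) = τ i) →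
      (N.Sat ν σ θ ↔ R (σ 0) (fun i => ν (ρ i)))

/-- The number-valued map `t` has an arithmetically definable graph. -/
class Tdef (N : Model.{u}) (𝒮 : Set (Set N.Num)) (t : (ℕ → N.Num) → N.Num) : Prop where
  out : N.Adef 𝒮 (fun _ ν => ν 0 = t (fun i => ν (i + 1)))

/-- Membership of a set in a parameter class, as a class. -/
class Param {N : Model.{u}} (𝒮 : Set (Set N.Num)) (A : Set N.Num) : Prop where
  out : A ∈ 𝒮

variable {N : Model.{u}} {𝒮 : Set (Set N.Num)}

theorem Adef.congr {R S : Set N.Num → (ℕ → N.Num) → Prop} (hR : N.Adef 𝒮 R)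
    (h : ∀ Y ν, S Y ν ↔ R Y ν) : N.Adef 𝒮 S := by
  have : S = R := by funext Y ν; exact propext (h Y ν)
  rwa [this]

theorem Adef.rename {R : Set N.Num → (ℕ → N.Num) → Prop} (hR : N.Adef 𝒮 R) (r : ℕ → ℕ) :
    N.Adef 𝒮 (fun Y ν => R Y (fun i => ν (r i))) := by
  obtain ⟨τ, hτ, h⟩ := hR.out
  refine ⟨τ, hτ, fun ρ κ hρ => h (ρ ∘ r) κ (hρ.mono ?_)⟩
  exact Set.compl_subset_compl.2 (Set.range_comp_subset_range r ρ)

instance Adef.not {R : Set N.Num → (ℕ → N.Num) → Prop} [hR : N.Adef 𝒮 R] :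
    N.Adef 𝒮 (fun Y ν => ¬ R Y ν) := by
  obtain ⟨τ, hτ, h⟩ := hR.out
  refine ⟨τ, hτ, fun ρ κ hρ => ?_⟩
  obtain ⟨θ, hθ, hs⟩ := h ρ κ hρ
  exact ⟨.not θ, hθ, fun ν σ hσ => not_congr (hs ν σ hσ)⟩

instance Adef.and {R S : Set N.Num → (ℕ → N.Num) → Prop} [hR : N.Adef 𝒮 R] [hS : N.Adef 𝒮 S] :
    N.Adef 𝒮 (fun Y ν => R Y ν ∧ S Y ν) := by
  obtain ⟨τ, hτ, h⟩ := hR.out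
  obtain ⟨τ', hτ', h'⟩ := hS.out
  -- The two parameter lists are interleaved: even places for the first conjunct, odd places for the
  -- second.
  refine ⟨fun i => if i % 2 = 0 then τ (i / 2) else τ' (i / 2), fun i => ?_, fun ρ κ hρ => ?_⟩
  · dsimp only; split_ifs
    exacts [hτ _, hτ' _]
  obtain ⟨θ, hθ, hs⟩ := h ρ (fun i => κ (2 * i)) hρ
  obtain ⟨θ', hθ', hs'⟩ := h' ρ (fun i => κ (2 * i + 1)) hρ
  refine ⟨.and θ θ', ⟨hθ, hθ'⟩, fun ν σ hσ => and_congr (hs ν σ fun i => ?_) (hs' ν σ fun i => ?_)⟩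
  · rw [hσ]; simp
  · rw [hσ]; dsimp only; rw [if_neg (by omega)]; congr 1; omega

instance Adef.all {R : Set N.Num → (ℕ → N.Num) → N.Num → Prop}
    [hR : N.Adef 𝒮 (fun Y ν => R Y (fun i => ν (i + 1)) (ν 0))] :
    N.Adef 𝒮 (fun Y ν => ∀ a, R Y ν a) := by
  obtain ⟨τ, hτ, h⟩ := hR.out
  refine ⟨τ, hτ, fun ρ κ hρ => ?_⟩
  -- A variable outside the range of `ρ` is fresh and can be bound; the range stays coinfinite after
  -- it is added.
  obtain ⟨k, hk⟩ := hρ.nonempty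
  have hk' : ∀ i, ρ i ≠ k := fun i hi => hk ⟨i, hi⟩
  obtain ⟨θ, hθ, hs⟩ := h (fun i => Nat.casesOn i k ρ) κ (by
    refine (hρ.sdiff (Set.finite_singleton k)).mono ?_
    rintro x ⟨hx, hxk⟩ ⟨i, hi⟩
    cases i with
    | zero => exact hxk hi.symm
    | succ i => exact hx ⟨i, hi⟩)
  refine ⟨.allNum k θ, hθ, fun ν σ hσ => forall_congr' fun a => ?_⟩
  rw [hs _ σ hσ]
  simp [hk']

instance Adef.imp {R S : Set N.Num → (ℕ → N.Num) → Prop} [hR : N.Adef 𝒮 R] [hS : N.Adef 𝒮 S] :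
    N.Adef 𝒮 (fun Y ν => R Y ν → S Y ν) :=
  (inferInstance : N.Adef 𝒮 (fun Y ν => ¬ (R Y ν ∧ ¬ S Y ν))).congr fun Y ν => by tauto

instance Adef.or {R S : Set N.Num → (ℕ → N.Num) → Prop} [hR : N.Adef 𝒮 R] [hS : N.Adef 𝒮 S] :
    N.Adef 𝒮 (fun Y ν => R Y ν ∨ S Y ν) :=
  (inferInstance : N.Adef 𝒮 (fun Y ν => ¬ (¬ R Y ν ∧ ¬ S Y ν))).congr fun Y ν => by tauto

instance Adef.iff {R S : Set N.Num → (ℕ → N.Num) → Prop} [hR : N.Adef 𝒮 R] [hS : N.Adef 𝒮 S] :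
    N.Adef 𝒮 (fun Y ν => R Y ν ↔ S Y ν) :=
  (inferInstance : N.Adef 𝒮 (fun Y ν => (R Y ν → S Y ν) ∧ (S Y ν → R Y ν))).congr
    fun Y ν => by tauto

instance Adef.ex {R : Set N.Num → (ℕ → N.Num) → N.Num → Prop}
    [hR : N.Adef 𝒮 (fun Y ν => R Y (fun i => ν (i + 1)) (ν 0))] :
    N.Adef 𝒮 (fun Y ν => ∃ a, R Y ν a) :=
  (@Adef.not _ _ _ (@Adef.all _ _ (fun Y ν a => ¬ R Y ν a) (@Adef.not _ _ _ hR))).congr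
    fun Y ν => by simp

theorem Adef.param_var {A : Set N.Num} (hA : A ∈ 𝒮) (i : ℕ) : N.Adef 𝒮 (fun _ ν => ν i ∈ A) :=
  ⟨fun _ => A, fun _ => hA, fun ρ κ _ => ⟨.mem (.var (ρ i)) (κ 0), trivial, fun ν σ hσ => by
    change ν (ρ i) ∈ σ (κ 0) ↔ ν (ρ i) ∈ A
    rw [hσ 0]⟩⟩

section Atoms

variable [h𝒮 : Nonempty 𝒮]

theorem Adef.of_formula {R : Set N.Num → (ℕ → N.Num) → Prop}
    (h : ∀ ρ : ℕ → ℕ, ∃ θ : Formula, θ.IsArithmetical ∧ ∀ ν σ,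
      (N.Sat ν σ θ ↔ R (σ 0) (fun i => ν (ρ i)))) : N.Adef 𝒮 R := by
  obtain ⟨A, hA⟩ := h𝒮
  refine ⟨fun _ => A, fun _ => hA, fun ρ κ _ => ?_⟩
  obtain ⟨θ, hθ, hs⟩ := h ρ
  exact ⟨θ, hθ, fun ν σ _ => hs ν σ⟩

theorem Adef.eq_var (i j : ℕ) : N.Adef 𝒮 (fun _ ν => ν i = ν j) :=
  .of_formula fun ρ => ⟨.eq (.var (ρ i)) (.var (ρ j)), trivial, fun _ _ => Iff.rfl⟩

theorem Adef.lt_var (i j : ℕ) : N.Adef 𝒮 (fun _ ν => N.lt (ν i) (ν j)) :=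
  .of_formula fun ρ => ⟨.lt (.var (ρ i)) (.var (ρ j)), trivial, fun _ _ => Iff.rfl⟩

theorem Adef.add_var (i j k : ℕ) : N.Adef 𝒮 (fun _ ν => ν i = N.add (ν j) (ν k)) :=
  .of_formula fun ρ => ⟨.eq (.var (ρ i)) (.add (.var (ρ j)) (.var (ρ k))), trivial,
    fun _ _ => Iff.rfl⟩

theorem Adef.mul_var (i j k : ℕ) : N.Adef 𝒮 (fun _ ν => ν i = N.mul (ν j) (ν k)) :=
  .of_formula fun ρ => ⟨.eq (.var (ρ i)) (.mul (.var (ρ j)) (.var (ρ k))), trivial,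
    fun _ _ => Iff.rfl⟩

theorem Adef.mem_var (i : ℕ) : N.Adef 𝒮 (fun Y ν => ν i ∈ Y) :=
  .of_formula fun ρ => ⟨.mem (.var (ρ i)) 0, trivial, fun _ _ => Iff.rfl⟩

instance Tdef.var (i : ℕ) : N.Tdef 𝒮 (fun ν => ν i) := ⟨Adef.eq_var 0 (i + 1)⟩

instance Tdef.zero : N.Tdef 𝒮 (fun _ => N.zero) :=
  ⟨.of_formula fun ρ => ⟨.eq (.var (ρ 0)) .zero, trivial, fun _ _ => Iff.rfl⟩⟩

instance Tdef.one : N.Tdef 𝒮 (fun _ => N.one) :=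
  ⟨.of_formula fun ρ => ⟨.eq (.var (ρ 0)) .one, trivial, fun _ _ => Iff.rfl⟩⟩

end Atoms

theorem Tdef.lift {t : (ℕ → N.Num) → N.Num} [h : N.Tdef 𝒮 t] (r : ℕ → ℕ) :
    N.Tdef 𝒮 (fun ν => t (fun i => ν (r i))) :=
  ⟨h.out.rename (fun i => Nat.casesOn i 0 (fun i => r i + 1))⟩

/-- Substitution of a definable term for the top of the stack. -/
theorem Adef.subst {R : Set N.Num → N.Num → (ℕ → N.Num) → Prop} {t : (ℕ → N.Num) → N.Num}
    (ht : N.Tdef 𝒮 t) (hR : N.Adef 𝒮 (fun Y ν => R Y (ν 0) (fun i => ν (i + 1)))) :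
    N.Adef 𝒮 (fun Y ν => R Y (t ν) ν) := by
  have := ht.out
  have : N.Adef 𝒮 (fun Y ν => ∃ a, a = t ν ∧ R Y a ν) :=
    @Adef.ex _ _ (fun Y ν a => a = t ν ∧ R Y a ν) (@Adef.and _ _ _ _ ht.out hR)
  exact this.congr fun Y ν => by simp

instance Adef.eq {t s : (ℕ → N.Num) → N.Num} [ht : N.Tdef 𝒮 t] [hs : N.Tdef 𝒮 s] :
    N.Adef 𝒮 (fun _ ν => t ν = s ν) :=
  Adef.subst (R := fun _ a ν => a = s ν) ht hs.out

theorem Adef.subst₂ {R : N.Num → N.Num → Prop} {t s : (ℕ → N.Num) → N.Num}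
    (ht : N.Tdef 𝒮 t) (hs : N.Tdef 𝒮 s) (hR : N.Adef 𝒮 (fun _ ν => R (ν 1) (ν 0))) :
    N.Adef 𝒮 (fun _ ν => R (t ν) (s ν)) :=
  Adef.subst (R := fun _ a ν => R a (s ν)) ht
    (Adef.subst (R := fun _ b ν => R (ν 0) b) (t := fun ν => s (fun i => ν (i + 1)))
      (Tdef.lift _) hR)

theorem Tdef.op {f : N.Num → N.Num → N.Num} {t s : (ℕ → N.Num) → N.Num}
    (ht : N.Tdef 𝒮 t) (hs : N.Tdef 𝒮 s) (hf : N.Adef 𝒮 (fun _ ν => ν 2 = f (ν 1) (ν 0))) :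
    N.Tdef 𝒮 (fun ν => f (t ν) (s ν)) :=
  ⟨Adef.subst (R := fun _ a ν => ν 0 = f a (s fun i => ν (i + 1))) (Tdef.lift (t := t) _)
    (Adef.subst (R := fun _ b ν => ν 1 = f (ν 0) b) (Tdef.lift (t := s) _) hf)⟩

section Atoms

variable [h𝒮 : Nonempty 𝒮]

instance Adef.lt {t s : (ℕ → N.Num) → N.Num} [ht : N.Tdef 𝒮 t] [hs : N.Tdef 𝒮 s] :
    N.Adef 𝒮 (fun _ ν => N.lt (t ν) (s ν)) :=
  Adef.subst₂ (R := N.lt) ht hs (Adef.lt_var 1 0)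

instance Adef.mem {t : (ℕ → N.Num) → N.Num} [ht : N.Tdef 𝒮 t] :
    N.Adef 𝒮 (fun Y ν => t ν ∈ Y) :=
  Adef.subst (R := fun Y a _ => a ∈ Y) ht (Adef.mem_var 0)

instance Adef.param {A : Set N.Num} [hA : Param 𝒮 A] {t : (ℕ → N.Num) → N.Num}
    [ht : N.Tdef 𝒮 t] : N.Adef 𝒮 (fun _ ν => t ν ∈ A) :=
  Adef.subst (R := fun _ a _ => a ∈ A) ht (Adef.param_var hA.out 0)

instance (priority := low) Adef.const (p : Prop) : N.Adef 𝒮 (fun _ _ => p) := by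
  by_cases hp : p
  · exact (Adef.eq_var 0 0).congr fun _ _ => by simp [hp]
  · exact (@Adef.not _ _ _ (Adef.eq_var 0 0)).congr fun _ _ => by simp [hp]

instance Tdef.add {t s : (ℕ → N.Num) → N.Num} [ht : N.Tdef 𝒮 t] [hs : N.Tdef 𝒮 s] :
    N.Tdef 𝒮 (fun ν => N.add (t ν) (s ν)) := Tdef.op ht hs (Adef.add_var 2 1 0)

instance Tdef.mul {t s : (ℕ → N.Num) → N.Num} [ht : N.Tdef 𝒮 t] [hs : N.Tdef 𝒮 s] :
    N.Tdef 𝒮 (fun ν => N.mul (t ν) (s ν)) := Tdef.op ht hs (Adef.mul_var 2 1 0)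

instance Tdef.pair {t s : (ℕ → N.Num) → N.Num} [ht : N.Tdef 𝒮 t] [hs : N.Tdef 𝒮 s] :
    N.Tdef 𝒮 (fun ν => N.pair (t ν) (s ν)) := by
  unfold Model.pair; infer_instance

end Atoms

theorem Adef.ex_fin [Nonempty 𝒮] {n : ℕ} {R : Fin n → Set N.Num → (ℕ → N.Num) → Prop}
    (h : ∀ i, N.Adef 𝒮 (R i)) : N.Adef 𝒮 (fun Y ν => ∃ i, R i Y ν) := by
  induction n with
  | zero => exact (Adef.const False).congr fun _ _ => by simp
  | succ n ih =>
    have h1 := ih fun i => h i.succ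
    exact (@Adef.or _ _ _ _ (h 0) h1).congr fun Y ν => Fin.exists_fin_succ

instance : Nonempty N.sets := N.sets_nonempty.to_subtype

/-- The stack is placed on the even variables, so that infinitely many odd ones remain for
quantifiers. -/
theorem sat_formula_of_adef {R : Set N.Num → (ℕ → N.Num) → Prop} (h : N.Adef 𝒮 R) :
    ∃ τ : ℕ → Set N.Num, (∀ i, τ i ∈ 𝒮) ∧ ∃ θ : Formula, θ.IsArithmetical ∧
      ∀ ν σ, (∀ i, σ (i + 1) = τ i) → (N.Sat ν σ θ ↔ R (σ 0) (fun i => ν (2 * i))) := by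
  obtain ⟨τ, hτ, h⟩ := h.out
  refine ⟨τ, hτ, h (fun i => 2 * i) (fun i => i + 1) ?_⟩
  refine Set.infinite_of_injective_forall_mem (f := fun i : ℕ => 2 * i + 1)
    (fun a b hab => by simpa using hab) ?_
  rintro i ⟨j, hj⟩
  dsimp only at hj; omega

variable [hN : Fact N.ModelsACA₀]

/-- Arithmetical comprehension, semantically. -/
theorem comprehension {R : Set N.Num → (ℕ → N.Num) → Prop} (h : N.Adef N.sets R)
    {Y : Set N.Num} (hY : Y ∈ N.sets) (ν : ℕ → N.Num) :
    {a | R Y (fun i => Nat.casesOn i a ν)} ∈ N.sets := by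
  obtain ⟨τ, hτ, θ, hθ, hs⟩ := sat_formula_of_adef h
  convert hN.out.arithmetical_comprehension θ hθ 0 (fun i => ν (i / 2 - 1))
    (fun i => Nat.casesOn i Y τ) (fun i => by cases i; exacts [hY, hτ _]) using 1
  ext a
  rw [Set.mem_ofPred_eq, Set.mem_ofPred_eq, hs _ _ fun _ => rfl]
  have : (fun i => Nat.casesOn i a ν : ℕ → N.Num) =
      fun i => Function.update (fun i => ν (i / 2 - 1)) 0 a (2 * i) := by
    funext i; cases i <;> simp [Function.update, mul_add]
  rw [this]
  exact Iff.rfl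

/-- Turns number parameters into set parameters, so that `Adef` has to keep track of the latter
only. -/
instance Param.singleton (a : N.Num) : Param N.sets {a} := by
  obtain ⟨Y, hY⟩ := N.sets_nonempty
  exact ⟨comprehension (Adef.eq_var 0 1) hY (fun _ => a)⟩

instance (priority := low) Tdef.const (a : N.Num) : N.Tdef N.sets (fun _ => a) :=
  ⟨Adef.param_var (Param.singleton a).out 0⟩

theorem setOf_mem (p : N.Num → Prop) [h : N.Adef N.sets (fun _ ν => p (ν 0))] :
    {a | p a} ∈ N.sets := by
  obtain ⟨Y, hY⟩ := N.sets_nonempty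
  exact comprehension h hY (fun _ => N.zero)

theorem induction_of (p : N.Num → Prop) [h : N.Adef N.sets (fun _ ν => p (ν 0))]
    (h0 : p N.zero) (hs : ∀ n, p n → p (N.add n N.one)) (n : N.Num) : p n :=
  hN.out.induction _ (setOf_mem p) h0 hs n

end Model

/-! ### Ordered semiring of numbers, pairing and codes of lists -/

namespace Model

variable {N : Model.{u}} [hN : Fact N.ModelsACA₀]

section Arithmetic

theorem num_zero_add (n : N.Num) : N.add N.zero n = n :=
  induction_of (fun n => N.add N.zero n = n) (hN.out.add_zero _)
    (fun n ih => by rw [hN.out.add_succ, ih]) n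

theorem num_succ_add (m n : N.Num) : N.add (N.add m N.one) n = N.add (N.add m n) N.one :=
  induction_of (fun n => N.add (N.add m N.one) n = N.add (N.add m n) N.one)
    (by rw [hN.out.add_zero, hN.out.add_zero])
    (fun n ih => by rw [hN.out.add_succ, ih, hN.out.add_succ]) n

theorem num_add_comm (m n : N.Num) : N.add m n = N.add n m :=
  induction_of (fun n => N.add m n = N.add n m)
    (by rw [hN.out.add_zero, num_zero_add])
    (fun n ih => by rw [hN.out.add_succ, ih, num_succ_add]) n

theorem num_add_assoc (k m n : N.Num) : N.add (N.add k m) n = N.add k (N.add m n) :=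
  induction_of (fun n => N.add (N.add k m) n = N.add k (N.add m n))
    (by rw [hN.out.add_zero, hN.out.add_zero])
    (fun n ih => by rw [hN.out.add_succ, ih, hN.out.add_succ, hN.out.add_succ]) n

theorem num_add_right_cancel (k m n : N.Num) : N.add m k = N.add n k → m = n :=
  induction_of (fun k => N.add m k = N.add n k → m = n)
    (by rw [hN.out.add_zero, hN.out.add_zero]; exact id)
    (fun k ih h => ih (by
      rw [hN.out.add_succ, hN.out.add_succ] at h; exact hN.out.succ_inj _ _ h)) k

theorem num_zero_mul (n : N.Num) : N.mul N.zero n = N.zero :=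
  induction_of (fun n => N.mul N.zero n = N.zero) (hN.out.mul_zero _)
    (fun n ih => by rw [hN.out.mul_succ, ih, hN.out.add_zero]) n

theorem num_succ_mul (m n : N.Num) : N.mul (N.add m N.one) n = N.add (N.mul m n) n :=
  induction_of (fun n => N.mul (N.add m N.one) n = N.add (N.mul m n) n)
    (by rw [hN.out.mul_zero, hN.out.mul_zero, hN.out.add_zero])
    (fun n ih => by
      rw [hN.out.mul_succ, ih, hN.out.mul_succ, num_add_assoc, num_add_assoc,
        hN.out.add_succ n m, num_add_comm n m, ← hN.out.add_succ]) n

theorem num_mul_comm (m n : N.Num) : N.mul m n = N.mul n m :=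
  induction_of (fun n => N.mul m n = N.mul n m)
    (by rw [hN.out.mul_zero, num_zero_mul])
    (fun n ih => by rw [hN.out.mul_succ, ih, num_succ_mul]) n

theorem num_mul_add (k m n : N.Num) : N.mul k (N.add m n) = N.add (N.mul k m) (N.mul k n) :=
  induction_of (fun n => N.mul k (N.add m n) = N.add (N.mul k m) (N.mul k n))
    (by rw [hN.out.add_zero, hN.out.mul_zero, hN.out.add_zero])
    (fun n ih => by rw [hN.out.add_succ, hN.out.mul_succ, ih, hN.out.mul_succ, num_add_assoc]) n

theorem num_mul_assoc (k m n : N.Num) : N.mul (N.mul k m) n = N.mul k (N.mul m n) :=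
  induction_of (fun n => N.mul (N.mul k m) n = N.mul k (N.mul m n))
    (by rw [hN.out.mul_zero, hN.out.mul_zero, hN.out.mul_zero])
    (fun n ih => by rw [hN.out.mul_succ, ih, hN.out.mul_succ, num_mul_add]) n

theorem num_mul_one (n : N.Num) : N.mul n N.one = n := by
  rw [← num_zero_add N.one, hN.out.mul_succ, hN.out.mul_zero, num_zero_add]

instance : CommSemiring N.Num where
  add := N.add
  zero := N.zero
  mul := N.mul
  one := N.one
  add_assoc := num_add_assoc
  zero_add := num_zero_add
  add_zero := hN.out.add_zero
  add_comm := num_add_comm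
  nsmul := @nsmulRec N.Num ⟨N.zero⟩ ⟨N.add⟩
  left_distrib := num_mul_add
  right_distrib a b c := (num_mul_comm _ _).trans ((num_mul_add c a b).trans
    (congrArg₂ N.add (num_mul_comm _ _) (num_mul_comm _ _)))
  zero_mul := num_zero_mul
  mul_zero := hN.out.mul_zero
  mul_assoc := num_mul_assoc
  one_mul a := (num_mul_comm _ _).trans (num_mul_one a)
  mul_one := num_mul_one
  mul_comm := num_mul_comm

theorem zero_or_succ (n : N.Num) : n = N.zero ∨ ∃ m, n = N.add m N.one :=
  induction_of (fun n => n = N.zero ∨ ∃ m, n = N.add m N.one) (.inl rfl)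
    (fun n _ => .inr ⟨n, rfl⟩) n

theorem num_lt_iff (m n : N.Num) : N.lt m n ↔ ∃ c, n = N.add m (N.add c N.one) :=
  induction_of (fun n => N.lt m n ↔ ∃ c, n = N.add m (N.add c N.one))
    (by
      refine iff_of_false (hN.out.not_lt_zero m) ?_
      rintro ⟨c, hc⟩
      exact hN.out.succ_ne_zero _ (hc.trans (hN.out.add_succ m c)).symm)
    (fun n ih => by
      rw [hN.out.lt_succ, ih]
      constructor
      · rintro (⟨c, rfl⟩ | rfl)
        · exact ⟨N.add c N.one, (hN.out.add_succ _ _).symm⟩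
        · exact ⟨N.zero, by rw [num_zero_add]⟩
      · rintro ⟨c, hc⟩
        rw [hN.out.add_succ] at hc
        have hc := hN.out.succ_inj _ _ hc
        rcases zero_or_succ c with rfl | ⟨d, rfl⟩
        · right; rw [hc, hN.out.add_zero]
        · exact .inl ⟨d, hc⟩) n

theorem num_lt_irrefl (n : N.Num) : ¬ N.lt n n := by
  rw [num_lt_iff]
  rintro ⟨c, hc⟩
  refine hN.out.succ_ne_zero c (num_add_right_cancel n _ _ ?_)
  rw [num_zero_add, num_add_comm]; exact hc.symm

theorem num_lt_trans {k m n : N.Num} (h : N.lt k m) (h' : N.lt m n) : N.lt k n := by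
  rw [num_lt_iff] at *
  obtain ⟨c, rfl⟩ := h
  obtain ⟨d, rfl⟩ := h'
  exact ⟨N.add (N.add c N.one) d, by rw [num_add_assoc, hN.out.add_succ]⟩

theorem num_zero_lt_succ (n : N.Num) : N.lt N.zero (N.add n N.one) := by
  rw [num_lt_iff]; exact ⟨n, (num_zero_add _).symm⟩

theorem num_lt_trichotomy (m n : N.Num) : N.lt m n ∨ m = n ∨ N.lt n m :=
  induction_of (fun m => N.lt m n ∨ m = n ∨ N.lt n m)
    (by
      rcases zero_or_succ n with rfl | ⟨d, rfl⟩
      · exact .inr (.inl rfl)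
      · exact .inl (num_zero_lt_succ d))
    (fun m ih => by
      rcases ih with h | rfl | h
      · rw [num_lt_iff] at h
        obtain ⟨c, rfl⟩ := h
        rcases zero_or_succ c with rfl | ⟨d, rfl⟩
        · right; left; rw [num_zero_add]
        · left; rw [num_lt_iff]
          exact ⟨d, by rw [num_add_assoc m, num_add_comm N.one (N.add d N.one)]⟩
      · right; right; rw [hN.out.lt_succ]; exact .inr rfl
      · right; right; rw [hN.out.lt_succ]; exact .inl h) m

open Classical in
noncomputable instance : LinearOrder N.Num where
  le a b := N.lt a b ∨ a = b
  lt := N.lt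
  le_refl a := .inr rfl
  le_trans a b c := by
    rintro (h | rfl) (h' | rfl)
    exacts [.inl (num_lt_trans h h'), .inl h, .inl h', .inr rfl]
  lt_iff_le_not_ge a b := by
    constructor
    · refine fun h => ⟨.inl h, ?_⟩
      rintro (h' | rfl)
      exacts [num_lt_irrefl _ (num_lt_trans h h'), num_lt_irrefl _ h]
    · rintro ⟨h | rfl, h'⟩
      exacts [h, (h' (.inr rfl)).elim]
  le_antisymm a b := by
    rintro (h | rfl) (h' | h')
    exacts [(num_lt_irrefl _ (num_lt_trans h h')).elim, h'.symm, rfl, rfl]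
  le_total a b := by
    rcases num_lt_trichotomy a b with h | h | h
    exacts [.inl (.inl h), .inl (.inr h), .inr (.inl h)]
  toDecidableLE := Classical.decRel _

theorem num_lt_succ_iff (m n : N.Num) : N.lt m (N.add n N.one) ↔ m ≤ n := hN.out.lt_succ m n

theorem num_le_iff (m n : N.Num) : m ≤ n ↔ ∃ c, n = m + c := by
  rw [← num_lt_succ_iff, num_lt_iff]
  constructor
  · rintro ⟨c, hc⟩
    exact ⟨c, hN.out.succ_inj _ _ (hc.trans (hN.out.add_succ m c))⟩
  · rintro ⟨c, rfl⟩
    exact ⟨c, (hN.out.add_succ m c).symm⟩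

instance : IsOrderedCancelAddMonoid N.Num where
  add_le_add_left a b h c := by
    rw [num_le_iff] at *
    obtain ⟨d, rfl⟩ := h
    exact ⟨d, by ring⟩
  le_of_add_le_add_left a b c h := by
    rw [num_le_iff] at *
    obtain ⟨d, hd⟩ := h
    refine ⟨d, num_add_right_cancel a _ _ ?_⟩
    change c + a = b + d + a
    rw [add_comm c, hd]; ring

theorem num_le_add (m n : N.Num) : m ≤ m + n := (num_le_iff _ _).2 ⟨n, rfl⟩

theorem num_lt_iff_succ_le (m n : N.Num) : m < n ↔ m + 1 ≤ n := by
  rw [num_le_iff]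
  refine (num_lt_iff m n).trans (exists_congr fun c => ?_)
  change n = m + (c + 1) ↔ _
  rw [add_assoc, add_comm c]

/-- With `s = i + j`, the code lies between `s²` and `s² + s`, hence below `(s + 1)²`. -/
theorem pair_lt_pair_of_add_lt {i j i' j' : N.Num} (h : i + j < i' + j') :
    N.pair i j < N.pair i' j' := by
  change (i + j) * (i + j) + i < (i' + j') * (i' + j') + i'
  rw [num_lt_iff_succ_le, num_le_iff] at h
  obtain ⟨c, hc⟩ := h
  rw [hc, num_lt_iff_succ_le, num_le_iff]
  exact ⟨j + (i + j) + 2 * (i + j) * c + 2 * c + c * c + i', by ring⟩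

theorem pair_inj {i j i' j' : N.Num} : N.pair i j = N.pair i' j' ↔ i = i' ∧ j = j' := by
  refine ⟨fun h => ?_, fun ⟨h, h'⟩ => by rw [h, h']⟩
  rcases lt_trichotomy (i + j) (i' + j') with hl | hs | hl
  · exact absurd h (pair_lt_pair_of_add_lt hl).ne
  · change (i + j) * (i + j) + i = (i' + j') * (i' + j') + i' at h
    rw [hs] at h
    have hi := add_left_cancel h
    subst hi
    exact ⟨rfl, add_left_cancel hs⟩
  · exact absurd h (pair_lt_pair_of_add_lt hl).ne'

theorem le_mul_self (n : N.Num) : n ≤ n * n := by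
  rcases zero_or_succ n with rfl | ⟨m, rfl⟩
  · exact (num_le_iff _ _).2 ⟨0, ((add_zero _).trans (mul_zero N.zero).symm).symm⟩
  · exact (num_le_iff _ _).2 ⟨m * (m + 1), show (m + 1) * (m + 1) = (m + 1) + m * (m + 1) by ring⟩

theorem left_le_pair (i j : N.Num) : i ≤ N.pair i j := by
  change i ≤ (i + j) * (i + j) + i
  rw [add_comm ((i + j) * (i + j))]; exact num_le_add _ _

theorem right_le_pair (i j : N.Num) : j ≤ N.pair i j := by
  change j ≤ (i + j) * (i + j) + i
  refine le_trans ?_ (num_le_add _ i)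
  refine le_trans ?_ (le_mul_self _)
  rw [add_comm]; exact num_le_add _ _

/-- Among the pairs with first component at least `k`, the pair `(k, 0)` has the least code. This
lets the flag of program `k` be decided before any other value at index `k` or later. -/
theorem lt_of_pair_lt_pair_zero {n m k : N.Num} (h : N.lt (N.pair n m) (N.pair k N.zero)) :
    N.lt n k := by
  change n < k
  change N.pair n m < N.pair k 0 at h
  by_contra! hk
  have hs : k + 0 ≤ n + m := by rw [add_zero]; exact hk.trans (num_le_add _ _)
  rcases hs.lt_or_eq with hs | hs
  · exact lt_asymm h (pair_lt_pair_of_add_lt hs)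
  · change (n + m) * (n + m) + n < (k + 0) * (k + 0) + k at h
    rw [hs] at h
    exact absurd (lt_of_add_lt_add_left h) hk.not_gt

theorem succ_inj_iff (m n : N.Num) : N.add m N.one = N.add n N.one ↔ m = n :=
  ⟨hN.out.succ_inj m n, fun h => h ▸ rfl⟩

theorem succ_ne_zero (n : N.Num) : N.add n N.one ≠ N.zero := hN.out.succ_ne_zero n

theorem not_lt_zero (n : N.Num) : ¬ N.lt n N.zero := hN.out.not_lt_zero n

end Arithmetic

/-- Strong induction for definable predicates. -/
theorem strong_induction (p : N.Num → Prop) [h : N.Adef N.sets (fun _ ν => p (ν 0))]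
    (hs : ∀ n, (∀ m, N.lt m n → p m) → p n) (n : N.Num) : p n := by
  have h' : N.Adef N.sets (fun _ ν => p (ν 0)) := h
  -- Once `p` is packaged as a set parameter, the bounded statement below is recognised as definable
  -- by instance search.
  have : Param N.sets {a | p a} := ⟨setOf_mem p⟩
  have key := induction_of (fun n => ∀ m, N.lt m n → m ∈ {a | p a})
    (fun m hm => (not_lt_zero m hm).elim)
    (fun n ih m hm => by
      rcases (hN.out.lt_succ m n).1 hm with hm | rfl
      exacts [ih m hm, hs m ih])
  exact hs n (key n)

theorem exists_least (p : N.Num → Prop) [h : N.Adef N.sets (fun _ ν => p (ν 0))]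
    (hp : ∃ n, p n) : ∃ n, p n ∧ ∀ m, N.lt m n → ¬ p m := by
  by_contra! hc
  obtain ⟨n, hn⟩ := hp
  refine strong_induction (fun n => ¬ p n) (fun n ih hn => ?_) n hn
  obtain ⟨m, hm, hpm⟩ := hc n hn
  exact ih m hm hpm

/-- The numeral of a standard number. -/
def numeral (N : Model.{u}) : ℕ → N.Num
  | 0 => N.zero
  | n + 1 => N.add (numeral N n) N.one

theorem numeral_inj {m n : ℕ} : N.numeral m = N.numeral n ↔ m = n := by
  refine ⟨fun h => ?_, fun h => h ▸ rfl⟩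
  induction m generalizing n with
  | zero =>
    cases n with
    | zero => rfl
    | succ n => exact (succ_ne_zero _ h.symm).elim
  | succ m ih =>
    cases n with
    | zero => exact (succ_ne_zero _ h).elim
    | succ n => rw [ih (hN.out.succ_inj _ _ h)]

/-- The code of the list with head `x` and tail coded by `y`; the empty list is coded by zero. -/
def cons (N : Model.{u}) (x y : N.Num) : N.Num := N.add (N.pair x y) N.one

instance Tdef.cons {𝒮 : Set (Set N.Num)} [Nonempty 𝒮] {t s : (ℕ → N.Num) → N.Num}
    [ht : N.Tdef 𝒮 t] [hs : N.Tdef 𝒮 s] : N.Tdef 𝒮 (fun ν => N.cons (t ν) (s ν)) := by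
  unfold Model.cons; infer_instance

theorem cons_inj {x y x' y' : N.Num} : N.cons x y = N.cons x' y' ↔ x = x' ∧ y = y' := by
  rw [cons, cons, succ_inj_iff, pair_inj]

theorem cons_ne_zero (x y : N.Num) : N.cons x y ≠ N.zero := succ_ne_zero _

theorem left_lt_cons (x y : N.Num) : N.lt x (N.cons x y) :=
  (num_lt_succ_iff _ _).2 (left_le_pair x y)

theorem right_lt_cons (x y : N.Num) : N.lt y (N.cons x y) :=
  (num_lt_succ_iff _ _).2 (right_le_pair x y)

end Model

/-! ### Absoluteness of arithmetical truth, and comprehension from a β-model -/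

namespace Model

theorem coded_eval {N : Model.{u}} (W : Set N.Num) (ν : ℕ → N.Num) (t : NumTerm) :
    (N.coded W).eval ν t = N.eval ν t := by
  induction t with
  | var x => rfl
  | zero => rfl
  | one => rfl
  | add s t hs ht => exact congrArg₂ N.add hs ht
  | mul s t hs ht => exact congrArg₂ N.mul hs ht

theorem coded_sat_iff {N : Model.{u}} (W : Set N.Num) {θ : Formula} (hθ : θ.IsArithmetical)
    (ν : ℕ → N.Num) (σ : ℕ → Set N.Num) : (N.coded W).Sat ν σ θ ↔ N.Sat ν σ θ := by
  induction θ generalizing ν with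
  | eq s t =>
    change (N.coded W).eval ν s = (N.coded W).eval ν t ↔ N.eval ν s = N.eval ν t
    rw [coded_eval, coded_eval]; exact Iff.rfl
  | lt s t =>
    change N.lt ((N.coded W).eval ν s) ((N.coded W).eval ν t) ↔ N.lt (N.eval ν s) (N.eval ν t)
    rw [coded_eval, coded_eval]
  | mem t X =>
    change (N.coded W).eval ν t ∈ σ X ↔ N.eval ν t ∈ σ X
    rw [coded_eval]; exact Iff.rfl
  | not φ ih => exact not_congr (ih hθ ν)
  | and φ ψ ih ih' => exact and_congr (ih hθ.1 ν) (ih' hθ.2 ν)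
  | allNum x φ ih => exact forall_congr' fun a => ih hθ _
  | allSet X φ ih => exact hθ.elim

/-- Over a coded model a set quantifier becomes a number quantifier over sections, so `Π¹₁`-truth in
the coded model is arithmetical in `W`. -/
theorem coded_sat_allSet_iff {N : Model.{u}} (W : Set N.Num) {θ : Formula}
    (hθ : θ.IsArithmetical) (Z : ℕ) (ν : ℕ → N.Num) (σ : ℕ → Set N.Num) :
    (N.coded W).Sat ν σ (.allSet Z θ) ↔
      ∀ n, N.Sat ν (Function.update σ Z (N.sec W n)) θ := by
  refine Set.forall_mem_range.trans (forall_congr' fun n => coded_sat_iff W hθ ν _)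

variable {N : Model.{u}} {𝒮 : Set (Set N.Num)}

theorem Tdef.eval [Nonempty 𝒮] {c : (ℕ → N.Num) → ℕ → N.Num}
    (hc : ∀ x, N.Tdef 𝒮 (fun ν => c ν x)) (t : NumTerm) :
    N.Tdef 𝒮 (fun ν => N.eval (c ν) t) := by
  induction t with
  | var x => exact hc x
  | zero => exact Tdef.zero
  | one => exact Tdef.one
  | add s t hs ht => exact Tdef.add
  | mul s t hs ht => exact Tdef.mul

/-- Satisfaction of an arithmetical formula is definable when the assignments are. -/
theorem Adef.sat [Nonempty 𝒮] {θ : Formula} (hθ : θ.IsArithmetical)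
    {c : (ℕ → N.Num) → ℕ → N.Num} {s : Set N.Num → (ℕ → N.Num) → ℕ → Set N.Num}
    (hc : ∀ x, N.Tdef 𝒮 (fun ν => c ν x))
    (hs : ∀ i, N.Adef 𝒮 (fun Y ν => ν 0 ∈ s Y (fun k => ν (k + 1)) i)) :
    N.Adef 𝒮 (fun Y ν => N.Sat (c ν) (s Y ν) θ) := by
  induction θ generalizing c s with
  | eq t t' =>
    have := Tdef.eval hc t
    have := Tdef.eval hc t'
    exact Adef.eq
  | lt t t' =>
    have := Tdef.eval hc t
    have := Tdef.eval hc t'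
    exact Adef.lt
  | mem t i => exact Adef.subst (R := fun Y a ν => a ∈ s Y ν i) (Tdef.eval hc t) (hs i)
  | not φ ih => exact @Adef.not _ _ _ (ih hθ hc hs)
  | and φ ψ ih ih' => exact @Adef.and _ _ _ _ (ih hθ.1 hc hs) (ih' hθ.2 hc hs)
  | allNum x φ ih =>
    refine @Adef.all _ _ (fun Y ν a => N.Sat (Function.update (c ν) x a) (s Y ν) φ) ?_
    refine ih (c := fun ν => Function.update (c fun i => ν (i + 1)) x (ν 0))
      (s := fun Y ν => s Y (fun i => ν (i + 1))) hθ (fun y => ?_) (fun i => ?_)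
    · by_cases h : y = x
      · subst h; simp only [Function.update_self]; exact Tdef.var 0
      · simp only [Function.update_of_ne h]; exact (hc y).lift _
    · exact (hs i).rename (fun k => Nat.casesOn k 0 (fun k => k + 2))
  | allSet X φ ih => exact hθ.elim

variable [hN : Fact N.ModelsACA₀]

instance Param.sec {W : Set N.Num} [Param N.sets W] (n : N.Num) : Param N.sets (N.sec W n) :=
  ⟨setOf_mem (fun m => N.pair m n ∈ W)⟩

theorem mem_sets_of_mem_coded {W X : Set N.Num} (hW : W ∈ N.sets) (hX : X ∈ (N.coded W).sets) :
    X ∈ N.sets := by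
  obtain ⟨n, rfl⟩ := hX
  have : Param N.sets W := ⟨hW⟩
  exact (Param.sec n).out

/-- A model of `ACA₀` containing a coded `β`-model that contains `X` satisfies
`Π¹₁`-comprehension for formulas with parameter `X`. -/
theorem IsCodedBeta.modelsPi11CA {W X : Set N.Num} (hβ : N.IsCodedBeta W)
    (hX : X ∈ (N.coded W).sets) : N.ModelsPi11CA X := by
  rintro _ ⟨Z, θ, hθ, rfl⟩ x ν
  have hPW : Param N.sets W := ⟨hβ.1⟩
  have hPX : Param N.sets X := ⟨mem_sets_of_mem_coded hβ.1 hX⟩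
  -- The β-property replaces truth in `N` by truth in the coded model, which is arithmetical in `W`
  -- and `X`.
  have : {a | N.Sat (Function.update ν x a) (fun _ => X) (.allSet Z θ)} = {a | ∀ n,
      N.Sat (Function.update ν x a) (Function.update (fun _ => X) Z (N.sec W n)) θ} := by
    ext a
    exact (hβ.2 _ ⟨Z, θ, hθ, rfl⟩ _ _ (fun _ => hX)).symm.trans
      (coded_sat_allSet_iff W hθ Z _ _)
  rw [this]
  have key : N.Adef N.sets (fun _ μ => N.Sat (Function.update ν x (μ 1))
      (Function.update (fun _ => X) Z (N.sec W (μ 0))) θ) := by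
    refine Adef.sat (c := fun μ => Function.update ν x (μ 1))
      (s := fun _ μ => Function.update (fun _ => X) Z (N.sec W (μ 0))) hθ (fun y => ?_)
      (fun i => ?_)
    · by_cases h : y = x
      · subst h; simp only [Function.update_self]; infer_instance
      · simp only [Function.update_of_ne h]; infer_instance
    · by_cases h : i = Z
      · subst h; simp only [Function.update_self]
        exact (inferInstance : N.Adef N.sets (fun _ μ => N.pair (μ 0) (μ 1) ∈ W))
      · simp only [Function.update_of_ne h]; infer_instance
  exact @setOf_mem _ _ (fun a => ∀ n, N.Sat (Function.update ν x a)
      (Function.update (fun _ => X) Z (N.sec W n)) θ)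
    (@Adef.all _ _ (fun _ μ n => N.Sat (Function.update ν x (μ 0))
      (Function.update (fun _ => X) Z (N.sec W n)) θ) key)

end Model

theorem Model.PseudoBetaReflectionATR.pseudoPi11CA {M : Model.{u}} (h : M.PseudoBetaReflectionATR) :
    M.PseudoPi11CA := by
  intro X hX
  obtain ⟨W₀, -, W₁, hW₁, hW, hA, hβ, hX'⟩ := h X hX
  have : Fact (M.coded W₁).ModelsACA₀ := ⟨hA.toModelsACA₀⟩
  exact ⟨W₁, hW₁, Model.mem_sets_of_mem_coded (N := M.coded W₁) hW hX', hA, hβ.modelsPi11CA hX'⟩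

/-! ### Recursion along the natural numbers, and list membership -/

namespace Model

/-- The pairs in `Y` whose second component is smaller than `j`. -/
def upTo (N : Model.{u}) (Y : Set N.Num) (j : N.Num) : Set N.Num :=
  {t | ∃ m i, t = N.pair m i ∧ N.lt i j ∧ N.pair m i ∈ Y}

/-- `E` is the membership relation between numbers and (codes of) lists. -/
structure IsListMem (N : Model.{u}) (E : Set N.Num) : Prop where
  nil : ∀ x, N.pair x N.zero ∉ E
  cons : ∀ x y z, N.pair z (N.cons x y) ∈ E ↔ z = x ∨ N.pair z y ∈ E

variable {N : Model.{u}} [hN : Fact N.ModelsACA₀]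

theorem pair_mem_upTo {Y : Set N.Num} {m i j : N.Num} :
    N.pair m i ∈ N.upTo Y j ↔ N.lt i j ∧ N.pair m i ∈ Y := by
  constructor
  · rintro ⟨m', i', h, h'⟩
    obtain ⟨rfl, rfl⟩ := pair_inj.1 h
    exact h'
  · exact fun h => ⟨m, i, rfl, h⟩

/-- The set of pairs `(i, j)` with `i ≤ j`. -/
def natOrder (N : Model.{u}) : Set N.Num := {t | ∃ i j, t = N.pair i j ∧ ¬ N.lt j i}

theorem natOrder_mem : N.natOrder ∈ N.sets :=
  setOf_mem (fun t => ∃ i j, t = N.pair i j ∧ ¬ N.lt j i)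

theorem le_natOrder_iff {i j : N.Num} : N.Le N.natOrder i j ↔ i ≤ j := by
  rw [← not_lt]
  constructor
  · rintro ⟨m', i', h, h'⟩
    obtain ⟨rfl, rfl⟩ := pair_inj.1 h
    exact h'
  · exact fun h => ⟨i, j, rfl, h⟩

theorem lt_natOrder_iff {i j : N.Num} : N.Lt N.natOrder i j ↔ N.lt i j := by
  unfold Lt
  rw [le_natOrder_iff, le_natOrder_iff]
  exact lt_iff_le_not_ge.symm

theorem mem_field_natOrder (i : N.Num) : i ∈ N.field N.natOrder := le_natOrder_iff.2 le_rfl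

theorem isWO_natOrder : N.IsWO N.natOrder := by
  refine ⟨⟨fun i j _ => ⟨mem_field_natOrder i, mem_field_natOrder j⟩, fun i j k => ?_,
    fun i j => ?_, fun i _ j _ => ?_⟩, ?_⟩
  · simp only [le_natOrder_iff]; exact le_trans
  · simp only [le_natOrder_iff]; exact le_antisymm
  · simp only [le_natOrder_iff]; exact le_total i j
  · rintro ⟨f, hf, hfun, hdesc⟩
    have : Param N.sets f := ⟨hf⟩
    obtain ⟨b, hb, -⟩ := hfun.2 N.zero
    -- Induction is on the value `a`, over all places `n` at once: no value is ever attained by a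
    -- descending sequence.
    refine strong_induction (fun a => ∀ n, N.pair n a ∉ f) (fun a ih n hn => ?_) b N.zero hb
    obtain ⟨c, hc, -⟩ := hfun.2 (N.add n N.one)
    exact ih c (lt_natOrder_iff.1 (hdesc n a c hn hc)) _ hc

/-- Arithmetical recursion along the natural numbers. -/
theorem ModelsATR₀.exists_iterate (hA : N.ModelsATR₀) {R : Set N.Num → N.Num → Prop}
    (h : N.Adef N.sets (fun Y ν => R Y (ν 0))) :
    ∃ Y ∈ N.sets, ∀ m j, N.pair m j ∈ Y ↔ R (N.upTo Y j) m := by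
  obtain ⟨τ, hτ, θ, hθ, hs⟩ := sat_formula_of_adef h
  obtain ⟨A, hA'⟩ := N.sets_nonempty
  obtain ⟨Y, hY, hYeq⟩ := hA.arithmetical_transfinite_recursion θ hθ 0 0 (fun _ => N.zero)
    (fun i => Nat.casesOn i A τ) (fun i => by cases i; exacts [hA', hτ _]) N.natOrder
    natOrder_mem isWO_natOrder
  refine ⟨Y, hY, fun m j => ?_⟩
  have hb : N.below N.natOrder Y j = N.upTo Y j := by
    ext t
    simp only [below, upTo, lt_natOrder_iff, Set.mem_ofPred_eq]
  have hmem : N.pair m j ∈ Y ↔ N.Sat (Function.update (fun _ => N.zero) 0 m)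
      (Function.update (fun i => Nat.casesOn i A τ) 0 (N.below N.natOrder Y j)) θ := by
    constructor
    · intro hm
      rw [hYeq] at hm
      obtain ⟨m', j', he, -, hm⟩ := hm
      obtain ⟨rfl, rfl⟩ := pair_inj.1 he
      exact hm
    · intro hm
      rw [hYeq]
      exact ⟨m, j, rfl, mem_field_natOrder j, hm⟩
  rw [hmem, hs, hb]
  · simp
  · intro i; simp

/-- Arithmetical recursion along the natural numbers, with access to the stage. -/
theorem ModelsATR₀.exists_recursion (hA : N.ModelsATR₀) (R : Set N.Num → N.Num → N.Num → Prop)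
    [h : N.Adef N.sets (fun Y ν => R Y (ν 1) (ν 0))] :
    ∃ Y ∈ N.sets, ∀ j, (∀ i, N.lt i j → ∃ m, N.pair m i ∈ Y) →
      ∀ m, N.pair m j ∈ Y ↔ R (N.upTo Y j) m j := by
  -- The operator sees only the part `Z` built so far. The stage `j` is recovered from it as the
  -- number whose predecessors are exactly the indices of nonempty columns; this is why earlier
  -- stages must be nonempty.
  obtain ⟨Y, hY, hrec⟩ := hA.exists_iterate
    (R := fun Z m => ∃ j, (∀ i, (∃ m', N.pair m' i ∈ Z) ↔ N.lt i j) ∧ R Z m j)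
    (@Adef.ex _ _ (fun Z ν j => (∀ i, (∃ m', N.pair m' i ∈ Z) ↔ N.lt i j) ∧ R Z (ν 0) j)
      (@Adef.and _ _ _ _ inferInstance h))
  refine ⟨Y, hY, fun j hj m => ?_⟩
  have hdom : ∀ i, (∃ m', N.pair m' i ∈ N.upTo Y j) ↔ N.lt i j := fun i => by
    simp only [pair_mem_upTo]
    exact ⟨fun ⟨_, h, _⟩ => h, fun h => (hj i h).imp fun _ h' => ⟨h, h'⟩⟩
  rw [hrec]
  constructor
  · rintro ⟨j', hj', hR⟩
    obtain rfl : j' = j := by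
      refine eq_of_forall_lt_iff fun i => ?_
      exact (hj' i).symm.trans (hdom i)
    exact hR
  · exact fun hR => ⟨j, hdom, hR⟩

/-- The recursion builds the relation `T` of being a final segment of a list. An element belongs to
a list if it is the head of some final segment. Every column of `T` is nonempty because `j` is a
final segment of itself. -/
theorem ModelsATR₀.exists_isListMem (hA : N.ModelsATR₀) : ∃ E ∈ N.sets, N.IsListMem E := by
  obtain ⟨T, hT, hrec⟩ := hA.exists_recursion
    (fun Z m j => m = j ∨ ∃ x y, j = N.cons x y ∧ N.pair m y ∈ Z)
  have : Param N.sets T := ⟨hT⟩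
  have hne : ∀ j, ∃ m, N.pair m j ∈ T :=
    strong_induction _ fun j ih => ⟨j, (hrec j ih j).2 (.inl rfl)⟩
  have hrec' : ∀ m j, N.pair m j ∈ T ↔ m = j ∨ ∃ x y, j = N.cons x y ∧ N.pair m y ∈ T := by
    intro m j
    rw [hrec j (fun i _ => hne i)]
    refine or_congr Iff.rfl (exists_congr fun x => exists_congr fun y => ?_)
    rw [pair_mem_upTo]
    refine and_congr_right fun h => ⟨And.right, fun h' => ⟨h ▸ right_lt_cons x y, h'⟩⟩
  refine ⟨_, setOf_mem (fun t => ∃ x a y, t = N.pair x a ∧ N.pair (N.cons x y) a ∈ T), ?_, ?_⟩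
  · rintro x ⟨x', a, y, he, hm⟩
    obtain ⟨rfl, rfl⟩ := pair_inj.1 he
    rcases (hrec' _ _).1 hm with h | ⟨_, _, h, -⟩
    exacts [cons_ne_zero _ _ h, cons_ne_zero _ _ h.symm]
  · have key : ∀ z a, N.pair z a ∈ {t | ∃ x a y, t = N.pair x a ∧ N.pair (N.cons x y) a ∈ T} ↔
        ∃ y, N.pair (N.cons z y) a ∈ T := by
      refine fun z a => ⟨?_, fun ⟨y, h⟩ => ⟨z, a, y, rfl, h⟩⟩
      rintro ⟨x', a', y, he, hm⟩
      obtain ⟨rfl, rfl⟩ := pair_inj.1 he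
      exact ⟨y, hm⟩
    intro x y z
    rw [key, key]
    constructor
    · rintro ⟨y', h⟩
      rcases (hrec' _ _).1 h with h | ⟨_, _, h, h'⟩
      · exact .inl (cons_inj.1 h).1
      · obtain ⟨rfl, rfl⟩ := cons_inj.1 h
        exact .inr ⟨y', h'⟩
    · rintro (rfl | ⟨y', h⟩)
      · exact ⟨y, (hrec' _ _).2 (.inl rfl)⟩
      · exact ⟨y', (hrec' _ _).2 (.inr ⟨x, y, rfl, h⟩)⟩

end Model

/-! ### Functions of the model, truth values and least counterexamples -/

namespace Model

/-- The graph of `f`, as a set of pairs (value, argument). -/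
def graph {N : Model.{u}} (f : N.Num → N.Num) : Set N.Num := {t | ∃ p, t = N.pair (f p) p}

/-- The function `f` belongs to the model. -/
class FunIn {N : Model.{u}} (f : N.Num → N.Num) : Prop where
  out : graph f ∈ N.sets

open Classical in
/-- The truth value of `p` as a number, zero meaning true. -/
noncomputable def tv (N : Model.{u}) (p : Prop) : N.Num := if p then N.zero else N.one

open Classical in
/-- The first component of a pair. -/
noncomputable def fst {N : Model.{u}} (u : N.Num) : N.Num :=
  if h : ∃ x y, u = N.pair x y then h.choose else N.zero

open Classical in
/-- The second component of a pair. -/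
noncomputable def snd {N : Model.{u}} (u : N.Num) : N.Num :=
  if h : ∃ y x, u = N.pair x y then h.choose else N.zero

open Classical in
/-- The universal number quantifier on truth-valued functions: zero if `f (x, u) = 0` for
all `x`, and otherwise the successor of the least counterexample. -/
noncomputable def allf {N : Model.{u}} (f : N.Num → N.Num) (u : N.Num) : N.Num :=
  if h : ∃ k, f (N.pair k u) ≠ N.zero ∧ ∀ x, N.lt x k → f (N.pair x u) = N.zero then
    N.add h.choose N.one else N.zero

variable {N : Model.{u}}

theorem eq_tv_iff {p : Prop} {a : N.Num} :
    a = N.tv p ↔ (p ∧ a = N.zero) ∨ (¬ p ∧ a = N.one) := by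
  unfold tv
  split_ifs with h <;> simp [h]

theorem fst_of_not_pair {u : N.Num} (h : ¬ ∃ x y, u = N.pair x y) : fst u = N.zero := by
  rw [fst, dif_neg h]

variable [hN : Fact N.ModelsACA₀]

theorem mem_graph {f : N.Num → N.Num} {m p : N.Num} : N.pair m p ∈ graph f ↔ m = f p := by
  constructor
  · rintro ⟨q, h⟩
    obtain ⟨rfl, rfl⟩ := pair_inj.1 h
    rfl
  · rintro rfl
    exact ⟨p, rfl⟩

instance Tdef.app {f : N.Num → N.Num} [hf : FunIn f] {t : (ℕ → N.Num) → N.Num}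
    [ht : N.Tdef N.sets t] : N.Tdef N.sets (fun ν => f (t ν)) := by
  have : Param N.sets (graph f) := ⟨hf.out⟩
  refine ⟨Adef.subst (R := fun _ a ν => ν 0 = f a) (Tdef.lift (t := t) _) ?_⟩
  exact (inferInstance : N.Adef N.sets (fun _ ν => N.pair (ν 1) (ν 0) ∈ graph f)).congr
    fun _ _ => mem_graph.symm

theorem FunIn.of_tdef (f : N.Num → N.Num) [h : N.Tdef N.sets (fun ν => f (ν 0))] : FunIn f :=
  ⟨@setOf_mem _ _ (fun t => ∃ p, t = N.pair (f p) p)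
    (@Adef.ex _ _ (fun _ ν p => ν 0 = N.pair (f p) p)
      (@Adef.eq _ _ _ _ _ (@Tdef.pair _ _ _ _ _ h _)))⟩

theorem tv_eq_zero_iff {p : Prop} : N.tv p = N.zero ↔ p := by
  unfold tv
  split_ifs with h
  · simp [h]
  · refine iff_of_false (fun h' => succ_ne_zero N.zero ?_) h
    rw [num_zero_add, h']

instance Tdef.tv {p : (ℕ → N.Num) → Prop} [h : N.Adef N.sets (fun _ ν => p ν)] :
    N.Tdef N.sets (fun ν => N.tv (p ν)) := by
  have h' := h.rename (fun i => i + 1)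
  refine ⟨Adef.congr (R := fun _ ν => (p (fun i => ν (i + 1)) ∧ ν 0 = N.zero) ∨
    (¬ p (fun i => ν (i + 1)) ∧ ν 0 = N.one)) ?_ fun _ _ => eq_tv_iff⟩
  have h1 := @Adef.not _ _ _ h'
  exact @Adef.or _ _ _ _ (@Adef.and _ _ _ _ h' inferInstance)
    (@Adef.and _ _ _ _ h1 inferInstance)

theorem fst_pair (x y : N.Num) : fst (N.pair x y) = x := by
  have h : ∃ x' y', N.pair x y = N.pair x' y' := ⟨x, y, rfl⟩
  rw [fst, dif_pos h]
  exact (pair_inj.1 h.choose_spec.choose_spec).1.symm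

theorem snd_pair (x y : N.Num) : snd (N.pair x y) = y := by
  have h : ∃ y' x', N.pair x y = N.pair x' y' := ⟨y, x, rfl⟩
  rw [snd, dif_pos h]
  exact (pair_inj.1 h.choose_spec.choose_spec).2.symm

theorem eq_fst_iff {a u : N.Num} :
    a = fst u ↔ (∃ y, u = N.pair a y) ∨ ((¬ ∃ x y, u = N.pair x y) ∧ a = N.zero) := by
  by_cases h : ∃ x y, u = N.pair x y
  · obtain ⟨x, y, rfl⟩ := h
    rw [fst_pair]
    constructor
    · rintro rfl; exact .inl ⟨y, rfl⟩
    · rintro (⟨y', h⟩ | ⟨h, -⟩)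
      exacts [(pair_inj.1 h).1.symm, (h ⟨x, y, rfl⟩).elim]
  · rw [fst_of_not_pair h]
    exact ⟨fun ha => .inr ⟨h, ha⟩, fun ha => ha.elim (fun ⟨y, hy⟩ => (h ⟨_, _, hy⟩).elim) And.right⟩

theorem eq_snd_iff {a u : N.Num} :
    a = snd u ↔ (∃ x, u = N.pair x a) ∨ ((¬ ∃ y x, u = N.pair x y) ∧ a = N.zero) := by
  by_cases h : ∃ y x, u = N.pair x y
  · obtain ⟨y, x, rfl⟩ := h
    rw [snd_pair]
    constructor
    · rintro rfl; exact .inl ⟨x, rfl⟩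
    · rintro (⟨x', h⟩ | ⟨h, -⟩)
      exacts [(pair_inj.1 h).2.symm, (h ⟨y, x, rfl⟩).elim]
  · rw [snd, dif_neg h]
    exact ⟨fun ha => .inr ⟨h, ha⟩, fun ha => ha.elim (fun ⟨y, hy⟩ => (h ⟨_, _, hy⟩).elim) And.right⟩

instance FunIn.fst : FunIn (fst : N.Num → N.Num) :=
  @FunIn.of_tdef _ _ _ ⟨(inferInstance : N.Adef N.sets fun _ ν => (∃ y, ν 1 = N.pair (ν 0) y) ∨
    ((¬ ∃ x y, ν 1 = N.pair x y) ∧ ν 0 = N.zero)).congr fun _ _ => eq_fst_iff⟩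

instance FunIn.snd : FunIn (snd : N.Num → N.Num) :=
  @FunIn.of_tdef _ _ _ ⟨(inferInstance : N.Adef N.sets fun _ ν => (∃ x, ν 1 = N.pair x (ν 0)) ∨
    ((¬ ∃ y x, ν 1 = N.pair x y) ∧ ν 0 = N.zero)).congr fun _ _ => eq_snd_iff⟩

/-- An arithmetical description of the graph, available because a definable failure has a least
instance; it puts `allf f` into the model. -/
theorem eq_allf_iff {f : N.Num → N.Num} [hf : FunIn f] {a u : N.Num} :
    a = allf f u ↔ (a = N.zero ∧ ∀ x, f (N.pair x u) = N.zero) ∨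
      ∃ k, a = N.add k N.one ∧ f (N.pair k u) ≠ N.zero ∧
        ∀ x, N.lt x k → f (N.pair x u) = N.zero := by
  unfold allf
  split_ifs with h
  · obtain ⟨hk, hk'⟩ := h.choose_spec
    constructor
    · exact fun ha => .inr ⟨_, ha, hk, hk'⟩
    · rintro (⟨-, h0⟩ | ⟨k, rfl, h1, h2⟩)
      · exact (hk (h0 _)).elim
      · rw [succ_inj_iff]
        rcases num_lt_trichotomy k h.choose with hl | hl | hl
        exacts [(h1 (hk' _ hl)).elim, hl, (hk (h2 _ hl)).elim]
  · have h0 : ∀ x, f (N.pair x u) = N.zero := by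
      by_contra! hc
      obtain ⟨k, hk, hk'⟩ := exists_least (fun x => ¬ f (N.pair x u) = N.zero) hc
      exact h ⟨k, hk, fun x hx => not_not.1 (hk' x hx)⟩
    constructor
    · exact fun ha => .inl ⟨ha, h0⟩
    · rintro (⟨ha, -⟩ | ⟨k, -, h1, -⟩)
      exacts [ha, (h1 (h0 k)).elim]

theorem allf_eq_zero_iff {f : N.Num → N.Num} [hf : FunIn f] {u : N.Num} :
    allf f u = N.zero ↔ ∀ x, f (N.pair x u) = N.zero := by
  rw [eq_comm, eq_allf_iff]
  constructor
  · rintro (⟨-, h⟩ | ⟨k, h, -⟩)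
    exacts [h, (succ_ne_zero k h.symm).elim]
  · exact fun h => .inl ⟨rfl, h⟩

instance FunIn.allf (f : N.Num → N.Num) [hf : FunIn f] : FunIn (allf f) := by
  refine @FunIn.of_tdef _ _ _ ⟨Adef.congr (R := fun _ ν =>
    (ν 0 = N.zero ∧ ∀ x, f (N.pair x (ν 1)) = N.zero) ∨
      ∃ k, ν 0 = N.add k N.one ∧ (¬ f (N.pair k (ν 1)) = N.zero) ∧
        ∀ x, N.lt x k → f (N.pair x (ν 1)) = N.zero) ?_ fun _ _ => eq_allf_iff⟩
  infer_instance

/-- Definition by cases. -/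
theorem FunIn.ite (p : N.Num → Prop) [DecidablePred p] (f g : N.Num → N.Num)
    [hp : N.Adef N.sets (fun _ ν => p (ν 1))] [hf : FunIn f] [hg : FunIn g] :
    FunIn (fun u => if p u then f u else g u) := by
  refine @FunIn.of_tdef _ _ _ ⟨Adef.congr (R := fun _ ν =>
    (p (ν 1) ∧ ν 0 = f (ν 1)) ∨ (¬ p (ν 1) ∧ ν 0 = g (ν 1))) inferInstance fun _ ν => ?_⟩
  by_cases h : p (ν 1) <;> simp [h]

/-- Finitely many functions can be joined into one. -/
theorem exists_join (fs : List (N.Num → N.Num)) (h : ∀ f ∈ fs, FunIn f) :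
    ∃ g : N.Num → N.Num, FunIn g ∧
      ∀ i (hi : i < fs.length) u, g (N.pair (N.numeral i) u) = fs[i] u := by
  classical
  induction fs using List.reverseRecOn with
  | nil =>
    exact ⟨fun _ => N.zero, @FunIn.of_tdef _ _ _ Tdef.zero, fun i hi => by simp at hi⟩
  | append_singleton fs f ih =>
    obtain ⟨g, hg, hgs⟩ := ih fun f' hf' => h f' (by simp [hf'])
    have hf : FunIn f := h f (by simp)
    have hfs : FunIn (fun u => f (snd u)) := FunIn.of_tdef _
    refine ⟨fun u => if fst u = N.numeral fs.length then f (snd u) else g u,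
      FunIn.ite (fun u => fst u = N.numeral fs.length) (fun u => f (snd u)) g, fun i hi u => ?_⟩
    simp only [fst_pair, snd_pair, numeral_inj]
    rw [List.length_append, List.length_singleton, Nat.lt_succ_iff_lt_or_eq] at hi
    rcases hi with hi | rfl
    · rw [if_neg hi.ne, hgs i hi, List.getElem_append_left]
    · simp

end Model

/-! ### Programs: arithmetical formulas as systems of local relations -/

namespace Model

/-- The local relations from which programs are built. The relation with tag `i` and parameter `p`
constrains the value `a` of one function at `u` by the values `b` at `v` and `c` at `w` of two other
functions and the value `d` at `z` of a parameter function. -/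
def row (N : Model.{u}) (X : Set N.Num) (p u a v b w c z d : N.Num) : Fin 13 → Prop
  | 0 => a = p
  | 1 => a = fst u
  | 2 => a = snd u
  | 3 => v = u → w = u → a = N.add b c
  | 4 => v = u → w = u → a = N.mul b c
  | 5 => w = u → v = c → a = b
  | 6 => v = u → w = u → a = N.tv (b = c)
  | 7 => v = u → w = u → a = N.tv (N.lt b c)
  | 8 => v = u → w = u → a = N.tv (¬ (b = N.zero ∧ c = N.zero))
  | 9 => z = u → a = d
  | 10 => (a = N.zero → ∀ x, v = N.pair x u → b = N.zero) ∧ ∀ k, a = N.add k N.one →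
      ∀ x, v = N.pair x u → (N.lt x k → b = N.zero) ∧ (x = k → ¬ b = N.zero)
  | 11 => a = N.tv (u ∈ X)
  | 12 => u = N.zero → a = N.zero

/-- An instruction: a local relation together with the three slots and the index of the parameter
that it relates. -/
structure Instr (N : Model.{u}) where
  tag : Fin 13
  p : N.Num
  l₁ : N.Num
  l₂ : N.Num
  l₃ : N.Num
  j : N.Num

/-- The function `g`, a sequence of functions indexed by slots, obeys the instruction `I`, the
parameter functions being given by `f`. -/
def Instr.Holds {N : Model.{u}} (X : Set N.Num) (f : N.Num → N.Num → N.Num) (g : N.Num → N.Num)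
    (I : Instr N) : Prop :=
  ∀ u v w z, N.row X I.p u (g (N.pair I.l₁ u)) v (g (N.pair I.l₂ v)) w (g (N.pair I.l₃ w))
    z (f I.j z) I.tag

/-- The program `L` computes the functionals `fs` of the function in slot zero: its
solutions are the sequences of functions that start with the values of `fs`. -/
structure Computes {N : Model.{u}} (X : Set N.Num) (f : N.Num → N.Num → N.Num)
    (fs : List ((N.Num → N.Num) → N.Num → N.Num)) (L : List (Instr N)) : Prop where
  head : ∃ tl, fs = id :: tl
  funIn : ∀ φ ∈ fs, ∀ y, FunIn y → FunIn (φ y)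
  holds_iff : ∀ g, FunIn g → ((∀ I ∈ L, I.Holds X f g) ↔ ∀ i (hi : i < fs.length) u,
    g (N.pair (N.numeral i) u) = fs[i] (fun m => g (N.pair N.zero m)) u)

/-- The functional `φ` can be computed by extending any program. -/
def Computable {N : Model.{u}} (X : Set N.Num) (f : N.Num → N.Num → N.Num)
    (φ : (N.Num → N.Num) → N.Num → N.Num) : Prop :=
  ∀ fs L, Computes X f fs L → ∃ fs' L', Computes X f fs' L' ∧ fs <+: fs' ∧ φ ∈ fs'

variable {N : Model.{u}} {X : Set N.Num} {f : N.Num → N.Num → N.Num}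

theorem computable_id : Computable X f id := fun fs L h => by
  obtain ⟨tl, rfl⟩ := h.head
  exact ⟨_, L, h, List.prefix_rfl, by simp⟩

theorem computes_nil : Computes X f [id] [] where
  head := ⟨[], rfl⟩
  funIn φ hφ y hy := by
    obtain rfl : φ = id := by simpa using hφ
    exact hy
  holds_iff g _ := by
    refine iff_of_true (by simp) fun i hi u => ?_
    obtain rfl : i = 0 := by simpa using hi
    rfl

theorem Computable.funIn {φ : (N.Num → N.Num) → N.Num → N.Num} (h : Computable X f φ)
    {y : N.Num → N.Num} (hy : FunIn y) : FunIn (φ y) := by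
  obtain ⟨fs', L', h', -, hφ⟩ := h _ _ computes_nil
  exact h'.funIn φ hφ y hy

variable [hN : Fact N.ModelsACA₀]

/-- An operation that is determined by one of the local relations preserves computability. -/
theorem Computable.op (op : (N.Num → N.Num) → (N.Num → N.Num) → N.Num → N.Num)
    (tag : Fin 13) (p j : N.Num) (hop : ∀ b c, FunIn b → FunIn c → FunIn (op b c))
    (hrow : ∀ a b c : N.Num → N.Num, FunIn a → FunIn b → FunIn c →
      ((∀ u v w z, N.row X p u (a u) v (b v) w (c w) z (f j z) tag) ↔ ∀ u, a u = op b c u))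
    {φ₁ φ₂ : (N.Num → N.Num) → N.Num → N.Num} (h₁ : Computable X f φ₁)
    (h₂ : Computable X f φ₂) : Computable X f (fun y => op (φ₁ y) (φ₂ y)) := by
  intro fs L hL
  obtain ⟨fs₁, L₁, hL₁, hp₁, hm₁⟩ := h₁ fs L hL
  obtain ⟨fs₂, L₂, hL₂, hp₂, hm₂⟩ := h₂ fs₁ L₁ hL₁
  obtain ⟨i₁, hi₁, he₁⟩ := List.getElem_of_mem (hp₂.subset hm₁)
  obtain ⟨i₂, hi₂, he₂⟩ := List.getElem_of_mem hm₂
  -- The value of the operation goes into the first unused slot, and one new instruction links it to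
  -- the slots of the arguments.
  refine ⟨fs₂ ++ [fun y => op (φ₁ y) (φ₂ y)], ⟨tag, p, N.numeral fs₂.length, N.numeral i₁,
    N.numeral i₂, j⟩ :: L₂, ⟨?_, ?_, ?_⟩, (hp₁.trans hp₂).trans (List.prefix_append _ _), by simp⟩
  · obtain ⟨tl, htl⟩ := hL₂.head
    exact ⟨tl ++ [fun y => op (φ₁ y) (φ₂ y)], by rw [htl]; rfl⟩
  · intro φ hφ y hy
    rcases List.mem_append.1 hφ with hφ | hφ
    · exact hL₂.funIn φ hφ y hy
    · rw [List.mem_singleton.1 hφ]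
      exact hop _ _ (h₁.funIn hy) (h₂.funIn hy)
  · intro g hg
    have hsplit : (∀ i (hi : i < (fs₂ ++ [fun y => op (φ₁ y) (φ₂ y)]).length) u,
        g (N.pair (N.numeral i) u) =
          (fs₂ ++ [fun y => op (φ₁ y) (φ₂ y)])[i] (fun m => g (N.pair N.zero m)) u) ↔
        (∀ u, g (N.pair (N.numeral fs₂.length) u) = op (φ₁ fun m => g (N.pair N.zero m))
          (φ₂ fun m => g (N.pair N.zero m)) u) ∧
        ∀ i (hi : i < fs₂.length) u,
          g (N.pair (N.numeral i) u) = fs₂[i] (fun m => g (N.pair N.zero m)) u := by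
      constructor
      · refine fun h => ⟨fun u => ?_, fun i hi u => ?_⟩
        · rw [h _ (by simp)]; simp
        · rw [h _ (by simp; omega), List.getElem_append_left hi]
      · rintro ⟨h, h'⟩ i hi u
        rw [List.length_append, List.length_singleton, Nat.lt_succ_iff_lt_or_eq] at hi
        rcases hi with hi | rfl
        · rw [h' i hi, List.getElem_append_left]
        · rw [h]; simp
    rw [hsplit, List.forall_mem_cons, hL₂.holds_iff g hg]
    -- Under the assumption that the old slots have their prescribed values, the new instruction
    -- speaks of the functions `φ₁` and `φ₂` of the input.
    refine and_congr_left fun hs => ?_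
    have e₁ : (fun v => g (N.pair (N.numeral i₁) v)) = φ₁ fun m => g (N.pair N.zero m) := by
      funext v; rw [hs i₁ hi₁, he₁]
    have e₂ : (fun v => g (N.pair (N.numeral i₂) v)) = φ₂ fun m => g (N.pair N.zero m) := by
      funext v; rw [hs i₂ hi₂, he₂]
    rw [← e₁, ← e₂]
    exact hrow _ _ _ (FunIn.of_tdef _) (FunIn.of_tdef _) (FunIn.of_tdef _)

theorem Computable.const (a : N.Num) : Computable X f (fun _ _ => a) :=
  Computable.op (fun _ _ _ => a) 0 a a (fun _ _ _ _ => FunIn.of_tdef _)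
    (fun _ _ _ _ _ _ => ⟨fun h u => h u u u u, fun h u _ _ _ => h u⟩) computable_id computable_id

theorem Computable.fst : Computable X f (fun _ => fst) :=
  Computable.op (fun _ _ => Model.fst) 1 N.zero N.zero (fun _ _ _ _ => FunIn.fst)
    (fun _ _ _ _ _ _ => ⟨fun h u => h u u u u, fun h u _ _ _ => h u⟩) computable_id computable_id

theorem Computable.snd : Computable X f (fun _ => snd) :=
  Computable.op (fun _ _ => Model.snd) 2 N.zero N.zero (fun _ _ _ _ => FunIn.snd)
    (fun _ _ _ _ _ _ => ⟨fun h u => h u u u u, fun h u _ _ _ => h u⟩) computable_id computable_id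

section

variable {φ₁ φ₂ : (N.Num → N.Num) → N.Num → N.Num} (h₁ : Computable X f φ₁)
  (h₂ : Computable X f φ₂)

include h₁ h₂

theorem Computable.add : Computable X f (fun y u => N.add (φ₁ y u) (φ₂ y u)) :=
  Computable.op (fun b c u => N.add (b u) (c u)) 3 N.zero N.zero (fun _ _ _ _ => FunIn.of_tdef _)
    (fun _ _ _ _ _ _ => ⟨fun h u => h u u u u rfl rfl, fun h u v w _ hv hw => by
      subst hv hw; exact h _⟩) h₁ h₂

theorem Computable.mul : Computable X f (fun y u => N.mul (φ₁ y u) (φ₂ y u)) :=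
  Computable.op (fun b c u => N.mul (b u) (c u)) 4 N.zero N.zero (fun _ _ _ _ => FunIn.of_tdef _)
    (fun _ _ _ _ _ _ => ⟨fun h u => h u u u u rfl rfl, fun h u v w _ hv hw => by
      subst hv hw; exact h _⟩) h₁ h₂

theorem Computable.comp : Computable X f (fun y u => φ₁ y (φ₂ y u)) :=
  Computable.op (fun b c u => b (c u)) 5 N.zero N.zero (fun _ _ _ _ => FunIn.of_tdef _)
    (fun _ _ c _ _ _ => ⟨fun h u => h u (c u) u u rfl rfl, fun h u v w _ hw hv => by
      subst hw hv; exact h _⟩) h₁ h₂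

theorem Computable.eq : Computable X f (fun y u => N.tv (φ₁ y u = φ₂ y u)) :=
  Computable.op (fun b c u => N.tv (b u = c u)) 6 N.zero N.zero (fun _ _ _ _ => FunIn.of_tdef _)
    (fun _ _ _ _ _ _ => ⟨fun h u => h u u u u rfl rfl, fun h u v w _ hv hw => by
      subst hv hw; exact h _⟩) h₁ h₂

theorem Computable.lt : Computable X f (fun y u => N.tv (N.lt (φ₁ y u) (φ₂ y u))) :=
  Computable.op (fun b c u => N.tv (N.lt (b u) (c u))) 7 N.zero N.zero
    (fun _ _ _ _ => FunIn.of_tdef _)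
    (fun _ _ _ _ _ _ => ⟨fun h u => h u u u u rfl rfl, fun h u v w _ hv hw => by
      subst hv hw; exact h _⟩) h₁ h₂

theorem Computable.nand :
    Computable X f (fun y u => N.tv (¬ (φ₁ y u = N.zero ∧ φ₂ y u = N.zero))) :=
  Computable.op (fun b c u => N.tv (¬ (b u = N.zero ∧ c u = N.zero))) 8 N.zero N.zero
    (fun _ _ _ _ => FunIn.of_tdef _)
    (fun _ _ _ _ _ _ => ⟨fun h u => h u u u u rfl rfl, fun h u v w _ hv hw => by
      subst hv hw; exact h _⟩) h₁ h₂

omit h₂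

/-- Relation 10 splits the specification into conditions on one value of `b` at a time: `a = 0`
requires zeros everywhere, `a = k + 1` requires zeros before `k` and a nonzero value at `k`. -/
theorem Computable.allf : Computable X f (fun y => allf (φ₁ y)) := by
  refine Computable.op (fun b _ => Model.allf b) 10 N.zero N.zero
    (fun _ _ _ _ => FunIn.allf _) (fun a b _ _ _ _ => ⟨fun h u => ?_, fun h u v w z => ?_⟩)
    h₁ h₁
  · rw [eq_allf_iff]
    rcases zero_or_succ (a u) with ha | ⟨k, ha⟩
    · exact .inl ⟨ha, fun x => (h u (N.pair x u) u u).1 ha x rfl⟩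
    · exact .inr ⟨k, ha, ((h u (N.pair k u) u u).2 k ha k rfl).2 rfl,
        fun x hx => ((h u (N.pair x u) u u).2 k ha x rfl).1 hx⟩
  · have := h u
    rw [eq_allf_iff] at this
    rcases this with ⟨ha, h0⟩ | ⟨k, ha, hk, h0⟩
    · refine ⟨?_, fun k hk => ?_⟩
      · rintro - x rfl; exact h0 x
      · exact (succ_ne_zero k (hk.symm.trans ha)).elim
    · refine ⟨fun ha' => (succ_ne_zero k (ha.symm.trans ha')).elim, ?_⟩
      rintro k' hk' x rfl
      obtain rfl : k' = k := hN.out.succ_inj _ _ (hk'.symm.trans ha)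
      exact ⟨h0 x, by rintro rfl; exact hk⟩

end

variable (hf : ∀ j, FunIn (f j))

include hf

theorem Computable.param (j : N.Num) : Computable X f (fun _ => f j) :=
  Computable.op (fun _ _ => f j) 9 N.zero j (fun _ _ _ _ => hf j)
    (fun _ _ _ _ _ _ => ⟨fun h u => h u u u u rfl, fun h u _ _ z hz => by
      subst hz; exact h _⟩) computable_id computable_id

omit hf in
theorem Computable.eval {c : ℕ → N.Num → N.Num} (hc : ∀ x, Computable X f (fun _ => c x))
    (t : NumTerm) : Computable X f (fun _ v => N.eval (fun x => c x v) t) := by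
  induction t with
  | var x => exact hc x
  | zero => exact Computable.const _
  | one => exact Computable.const _
  | add s t hs ht => exact hs.add ht
  | mul s t hs ht => exact hs.mul ht

/-- Truth of an arithmetical formula is computable from the set variable `Z`, if the other set
variables denote parameters. -/
theorem exists_computable_sat {θ : Formula} (hθ : θ.IsArithmetical) (Z : ℕ)
    {σ : ℕ → Set N.Num} (hσ : ∀ i, ∃ j, ∀ m, f j m = N.zero ↔ m ∈ σ i)
    {c : ℕ → N.Num → N.Num} (hc : ∀ x, Computable X f (fun _ => c x)) :
    ∃ φ, Computable X f φ ∧ ∀ y, FunIn y → ∀ v, φ y v = N.zero ↔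
      N.Sat (fun x => c x v) (Function.update σ Z {m | y m = N.zero}) θ := by
  induction θ generalizing c with
  | eq s t =>
    exact ⟨_, (Computable.eval hc s).eq (Computable.eval hc t), fun y _ v => tv_eq_zero_iff⟩
  | lt s t =>
    exact ⟨_, (Computable.eval hc s).lt (Computable.eval hc t), fun y _ v => tv_eq_zero_iff⟩
  | mem t i =>
    by_cases hi : i = Z
    · subst hi
      refine ⟨_, computable_id.comp (Computable.eval hc t), fun y _ v => ?_⟩
      simp only [Sat, Function.update_self]
      exact Iff.rfl
    · obtain ⟨j, hj⟩ := hσ i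
      refine ⟨_, (Computable.param hf j).comp (Computable.eval hc t), fun y _ v => ?_⟩
      simp only [Sat, Function.update_of_ne hi, hj]
  | not θ ih =>
    obtain ⟨φ, hφ, h⟩ := ih hθ hc
    refine ⟨_, hφ.nand hφ, fun y hy v => ?_⟩
    rw [tv_eq_zero_iff, and_self, h y hy]
    exact Iff.rfl
  | and θ θ' ih ih' =>
    obtain ⟨φ, hφ, h⟩ := ih hθ.1 hc
    obtain ⟨φ', hφ', h'⟩ := ih' hθ.2 hc
    refine ⟨_, (hφ.nand hφ').nand (hφ.nand hφ'), fun y hy v => ?_⟩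
    rw [tv_eq_zero_iff, and_self, tv_eq_zero_iff, not_not, h y hy, h' y hy]
    exact Iff.rfl
  | allNum x θ ih =>
    -- The argument becomes a pair: its first component is the quantified number, its second the old
    -- argument.
    have hc' : ∀ y, Computable X f
        (fun _ => Function.update (fun y v => c y (snd v)) x fst y) := fun y => by
      by_cases hy : y = x
      · subst hy; rw [Function.update_self]; exact Computable.fst
      · rw [Function.update_of_ne hy]; exact (hc y).comp Computable.snd
    obtain ⟨φ, hφ, h⟩ := ih hθ hc'
    refine ⟨_, hφ.allf, fun y hy v => ?_⟩
    have := hφ.funIn hy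
    rw [allf_eq_zero_iff]
    refine forall_congr' fun a => ?_
    rw [h y hy]
    have : (fun x' => Function.update (fun y v => c y (snd v)) x fst x' (N.pair a v)) =
        Function.update (fun x => c x v) x a := by
      funext x'
      by_cases hx : x' = x
      · subst hx; rw [Function.update_self, Function.update_self, fst_pair]
      · rw [Function.update_of_ne hx, Function.update_of_ne hx, snd_pair]
    rw [this]
  | allSet i θ ih => exact hθ.elim

/-- The existence of a set with an arithmetical property amounts to the solvability of
a program. -/
theorem exists_program {θ : Formula} (hθ : θ.IsArithmetical) (Z : ℕ) {σ : ℕ → Set N.Num}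
    (hσ : ∀ i, ∃ j, ∀ m, f j m = N.zero ↔ m ∈ σ i) (ν : ℕ → N.Num) :
    ∃ L : List (Instr N),
      (∀ A ∈ N.sets, N.Sat ν (Function.update σ Z A) θ →
        ∃ g, FunIn g ∧ ∀ I ∈ L, I.Holds X f g) ∧
      ∀ g, FunIn g → (∀ I ∈ L, I.Holds X f g) →
        N.Sat ν (Function.update σ Z {m | g (N.pair N.zero m) = N.zero}) θ := by
  obtain ⟨φ, hφ, h⟩ := exists_computable_sat (X := X) hf hθ Z hσ
    (c := fun x _ => ν x) (fun x => Computable.const _)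
  obtain ⟨fs, L, hL, -, hm⟩ := hφ _ _ computes_nil
  obtain ⟨i, hi, he⟩ := List.getElem_of_mem hm
  -- The added instruction with tag 12 asserts that the truth value of the whole formula, held in
  -- slot `i`, is zero. The argument is immaterial, as all number variables were interpreted by
  -- constants.
  have hIff : ∀ g : N.Num → N.Num,
      (⟨12, N.zero, N.numeral i, N.zero, N.zero, N.zero⟩ : Instr N).Holds X f g ↔
        g (N.pair (N.numeral i) N.zero) = N.zero := fun g =>
    ⟨fun h => h N.zero N.zero N.zero N.zero rfl, by rintro h _ _ _ _ rfl; exact h⟩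
  refine ⟨⟨12, N.zero, N.numeral i, N.zero, N.zero, N.zero⟩ :: L, fun A hA hs => ?_,
    fun g hg hs => ?_⟩
  · have : Param N.sets A := ⟨hA⟩
    have hy : FunIn fun m => N.tv (m ∈ A) := FunIn.of_tdef _
    obtain ⟨g, hg, hgs⟩ := exists_join (fs.map fun φ => φ fun m => N.tv (m ∈ A)) (by
      intro f' hf'
      obtain ⟨φ', hφ', rfl⟩ := List.mem_map.1 hf'
      exact hL.funIn φ' hφ' _ hy)
    have hg0 : (fun m => g (N.pair N.zero m)) = fun m => N.tv (m ∈ A) := by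
      obtain ⟨tl, rfl⟩ := hL.head
      funext m
      exact hgs 0 (by simp) m
    refine ⟨g, hg, List.forall_mem_cons.2 ⟨?_, (hL.holds_iff g hg).2 fun k hk u => ?_⟩⟩
    · rw [hIff, hgs i (by simpa using hi), List.getElem_map, he, h _ hy]
      simpa only [tv_eq_zero_iff, Set.ofPred_mem_eq] using hs
    · rw [hgs k (by simpa using hk), List.getElem_map, hg0]
  · rw [List.forall_mem_cons, hIff, hL.holds_iff g hg] at hs
    obtain ⟨h0, hs⟩ := hs
    rw [hs i hi, he, h _ (FunIn.of_tdef _)] at h0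
    exact h0

end Model

/-! ### Acceptance, extendible finite conditions and the leftmost path -/

namespace Model

/-- The tuple that represents an instance of a local relation. -/
abbrev tuple (N : Model.{u}) (t p u a v b w c z d : N.Num) : N.Num :=
  N.pair t (N.pair p (N.pair u (N.pair a (N.pair v (N.pair b (N.pair w (N.pair c
    (N.pair z d))))))))

/-- The code of an instruction. -/
abbrev instrCode (N : Model.{u}) (t p l₁ l₂ l₃ j : N.Num) : N.Num :=
  N.pair t (N.pair p (N.pair l₁ (N.pair l₂ (N.pair l₃ j))))

/-- The position in a sequence of functions `F n l` of the value `F n l u`. Position `(n, 0)` is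
reserved for a flag. -/
abbrev pos (N : Model.{u}) (n l u : N.Num) : N.Num := N.pair n (N.pair N.one (N.pair l u))

/-- List membership, read off from the set `S`. -/
abbrev InList (N : Model.{u}) (S : Set N.Num) (x y : N.Num) : Prop :=
  N.pair (N.pair x y) N.one ∈ S

/-- The set `S` codes list membership and the table of the local relations. -/
structure Codes (N : Model.{u}) (X S : Set N.Num) : Prop where
  nil : ∀ x, ¬ N.InList S x N.zero
  cons : ∀ x y z, N.InList S z (N.cons x y) ↔ z = x ∨ N.InList S z y
  table : ∀ (i : Fin 13) p u a v b w c z d,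
    N.pair (N.tuple (N.numeral i) p u a v b w c z d) N.zero ∈ S ↔ N.row X p u a v b w c z d i

theorem numeral_coded {N : Model.{u}} (W : Set N.Num) (i : ℕ) :
    (N.coded W).numeral i = N.numeral i := by
  induction i with
  | zero => rfl
  | succ i ih => exact congrArg (fun x => N.add x N.one) ih

/-- The conditions quantify over numbers only, and these are shared by the structure and its coded
models. -/
theorem Codes.coded {N : Model.{u}} {X S : Set N.Num} (h : N.Codes X S) (W : Set N.Num) :
    (N.coded W).Codes X S where
  nil := h.nil
  cons := h.cons
  table i p u a v b w c z d := by
    rw [numeral_coded]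
    refine (h.table i p u a v b w c z d).trans ?_
    fin_cases i <;> exact Iff.rfl

/-- The function `G` is accepted: whenever the flag of a program `n` is zero, the function
at index `n` obeys all instructions of this program. -/
def Accepts (N : Model.{u}) (S : Set N.Num) (G : N.Num → N.Num) : Prop :=
  ∀ n, G (N.pair n N.zero) = N.zero → ∀ t p l₁ l₂ l₃ j,
    N.InList S (N.instrCode t p l₁ l₂ l₃ j) n → N.lt j n → ∀ u v w z,
      N.pair (N.tuple t p u (G (N.pos n l₁ u)) v (G (N.pos n l₂ v)) w (G (N.pos n l₃ w))
        z (G (N.pos j N.zero z))) N.zero ∈ S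

/-- A version of `Accepts` for the graph of a function. -/
def GraphAccepts (N : Model.{u}) (S Y : Set N.Num) : Prop :=
  ∀ n, N.pair N.zero (N.pair n N.zero) ∈ Y → ∀ t p l₁ l₂ l₃ j,
    N.InList S (N.instrCode t p l₁ l₂ l₃ j) n → N.lt j n → ∀ u v w z a b c d,
      N.pair a (N.pos n l₁ u) ∈ Y → N.pair b (N.pos n l₂ v) ∈ Y → N.pair c (N.pos n l₃ w) ∈ Y →
        N.pair d (N.pos j N.zero z) ∈ Y → N.pair (N.tuple t p u a v b w c z d) N.zero ∈ S

/-- The finite condition coded by the list `s` extends to the graph `Y` of an accepted function. -/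
def Extends (N : Model.{u}) (S Y : Set N.Num) (s : N.Num) : Prop :=
  (∀ p, ∃ m, N.pair m p ∈ Y ∧ ∀ m', N.pair m' p ∈ Y → m' = m) ∧
    (∀ x, N.InList S x s → x ∈ Y) ∧ N.GraphAccepts S Y

variable {N : Model.{u}} {S : Set N.Num}

theorem graphAccepts_iff {Y : Set N.Num} {G : N.Num → N.Num}
    (h : ∀ m p, N.pair m p ∈ Y ↔ m = G p) : N.GraphAccepts S Y ↔ N.Accepts S G := by
  unfold GraphAccepts Accepts
  simp only [h]
  constructor
  · intro H n hn t p l₁ l₂ l₃ j hl hj u v w z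
    exact H n hn.symm t p l₁ l₂ l₃ j hl hj u v w z _ _ _ _ rfl rfl rfl rfl
  · rintro H n hn t p l₁ l₂ l₃ j hl hj u v w z _ _ _ _ rfl rfl rfl rfl
    exact H n hn.symm t p l₁ l₂ l₃ j hl hj u v w z

/-- With parameter class `{S}`, all free set variables other than `Y` can be interpreted by `S`, as
`Π¹₁-CA₀(S)` demands. -/
theorem ModelsPi11CA.setOf_forall_mem (h : N.ModelsPi11CA S) {R : Set N.Num → N.Num → Prop}
    (hR : N.Adef {S} (fun Y ν => R Y (ν 0))) : {a | ∀ Y ∈ N.sets, R Y a} ∈ N.sets := by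
  obtain ⟨τ, hτ, θ, hθ, hs⟩ := sat_formula_of_adef hR
  convert h (.allSet 0 θ) ⟨0, θ, hθ, rfl⟩ 0 (fun _ => N.zero) using 1
  ext a
  refine forall₂_congr fun Y _ => ?_
  rw [hs]
  · simp
  · intro i; rw [hτ i]; simp

instance Param.self : Param {S} S := ⟨rfl⟩

-- The graph formulation of acceptance is needed here: functions enter through the set variable, and
-- `S` is the only parameter.
set_option synthInstance.maxSize 2000 in
set_option synthInstance.maxHeartbeats 400000 in
theorem adef_extends : N.Adef {S} (fun Y ν => N.Extends S Y (ν 0)) := by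
  unfold Extends GraphAccepts InList tuple instrCode pos
  infer_instance

/-- The complement of a set given by `Π¹₁`-comprehension with parameter `S`; this is the sole use of
that comprehension. -/
theorem exists_extending_mem (h : N.ModelsPi11CA S) [Fact N.ModelsACA₀] :
    {s | ∃ Y ∈ N.sets, N.Extends S Y s} ∈ N.sets := by
  have : Param N.sets {s | ∀ Y ∈ N.sets, ¬ N.Extends S Y s} :=
    ⟨h.setOf_forall_mem (R := fun Y s => ¬ N.Extends S Y s) (@Adef.not _ _ _ adef_extends)⟩
  convert setOf_mem (fun s => ¬ s ∈ {s | ∀ Y ∈ N.sets, ¬ N.Extends S Y s}) using 1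
  ext s
  simp [Set.mem_ofPred_eq]

theorem Extends.exists_fun {Y : Set N.Num} {s : N.Num} (h : N.Extends S Y s) :
    ∃ G : N.Num → N.Num, N.Accepts S G ∧ (∀ m p, N.pair m p ∈ Y ↔ m = G p) ∧
      ∀ m p, N.InList S (N.pair m p) s → m = G p := by
  obtain ⟨h1, h2, h3⟩ := h
  choose G hG hG' using h1
  have hY : ∀ m p, N.pair m p ∈ Y ↔ m = G p := fun m p => ⟨hG' p m, by rintro rfl; exact hG p⟩
  exact ⟨G, (graphAccepts_iff hY).1 h3, hY, fun m p hm => (hY m p).1 (h2 _ hm)⟩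

variable [hN : Fact N.ModelsACA₀]

theorem extends_graph_iff {G : N.Num → N.Num} {s : N.Num} : N.Extends S (graph G) s ↔
    (∀ x, N.InList S x s → ∃ p, x = N.pair (G p) p) ∧ N.Accepts S G := by
  unfold Extends
  rw [graphAccepts_iff (G := G) fun m p => mem_graph]
  refine and_iff_right fun p => ⟨G p, mem_graph.2 rfl, fun m' hm' => mem_graph.1 hm'⟩

/-- The list `s` codes the restriction of `G` to the numbers below `j`. -/
def Restriction (N : Model.{u}) (S : Set N.Num) (G : N.Num → N.Num) (j s : N.Num) : Prop :=
  ∀ x, N.InList S x s ↔ ∃ i, N.lt i j ∧ x = N.pair (G i) i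

/-- Leftmost paths exist: if every condition in `K` can be extended by a value at any given place,
then there is a function all of whose restrictions are in `K`, with each value least possible. -/
theorem ModelsATR₀.exists_leftmost (hA : N.ModelsATR₀) (hS : S ∈ N.sets)
    (hnil : ∀ x, ¬ N.InList S x N.zero)
    (hcons : ∀ x y z, N.InList S z (N.cons x y) ↔ z = x ∨ N.InList S z y)
    {K : Set N.Num} (hK : K ∈ N.sets)
    (hext : ∀ s s', (∀ x, N.InList S x s ↔ N.InList S x s') → s ∈ K → s' ∈ K)
    (h0 : N.zero ∈ K) (hstep : ∀ s ∈ K, ∀ j, ∃ m, N.cons (N.pair m j) s ∈ K) :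
    ∃ G : N.Num → N.Num, FunIn G ∧
      (∀ j, ∃ s ∈ K, N.Restriction S G j s) ∧
      ∀ j s m, N.Restriction S G j s → N.cons (N.pair m j) s ∈ K → ¬ N.lt m (G j) := by
  have : Param N.sets S := ⟨hS⟩
  have : Param N.sets K := ⟨hK⟩
  have hext' : ∀ x s s', (∀ x, N.InList S x s ↔ N.InList S x s') → N.cons x s ∈ K →
      N.cons x s' ∈ K := fun x s s' h =>
    hext _ _ fun z => by rw [hcons, hcons, h]
  -- At stage `j`, a list `s` codes the values chosen so far, and `m` is the least value that keeps
  -- the condition in `K`. A finite set has several list codes, so `hext` is needed for uniqueness.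
  obtain ⟨Y, hY, hrec⟩ := hA.exists_recursion (fun Z m j => ∃ s, (∀ x, N.InList S x s ↔ x ∈ Z) ∧
    N.cons (N.pair m j) s ∈ K ∧ ∀ m', N.lt m' m → ¬ N.cons (N.pair m' j) s ∈ K)
  have : Param N.sets Y := ⟨hY⟩
  have huniq : ∀ j, (∀ i, N.lt i j → ∃ m, N.pair m i ∈ Y) → ∀ m m', N.pair m j ∈ Y →
      N.pair m' j ∈ Y → m = m' := by
    intro j hj m m' hm hm'
    obtain ⟨s, hs, h1, h2⟩ := (hrec j hj m).1 hm
    obtain ⟨s', hs', h1', h2'⟩ := (hrec j hj m').1 hm'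
    have he : ∀ x, N.InList S x s ↔ N.InList S x s' := fun x => (hs x).trans (hs' x).symm
    rcases num_lt_trichotomy m m' with h | h | h
    · exact (h2' m h (hext' _ _ _ he h1)).elim
    · exact h
    · exact (h2 m' h (hext' _ _ _ (fun x => (he x).symm) h1')).elim
  -- Both claims are proved by one induction: the recursion clause applies at `j` only when all
  -- earlier values exist, and the next value requires a list code of them in `K`.
  have key : ∀ j, (∃ s, s ∈ K ∧ ∀ x, N.InList S x s ↔
      ∃ m i, x = N.pair m i ∧ N.lt i j ∧ N.pair m i ∈ Y) ∧
      ∀ i, N.lt i j → ∃ m, N.pair m i ∈ Y := by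
    refine induction_of _ ⟨⟨N.zero, h0, fun x => ?_⟩, fun i hi => (not_lt_zero i hi).elim⟩
      (fun j ih => ?_)
    · exact iff_of_false (hnil x) fun ⟨m, i, _, hi, _⟩ => not_lt_zero i hi
    · obtain ⟨⟨s, hsK, hs⟩, hj⟩ := ih
      obtain ⟨m, hm, hm'⟩ := exists_least (fun m => N.cons (N.pair m j) s ∈ K) (hstep s hsK j)
      have hmY : N.pair m j ∈ Y := (hrec j hj m).2 ⟨s, hs, hm, hm'⟩
      refine ⟨⟨_, hm, fun x => ?_⟩, fun i hi => ?_⟩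
      · rw [hcons, hs]
        constructor
        · rintro (rfl | ⟨m', i, rfl, hi, h⟩)
          · exact ⟨m, j, rfl, (hN.out.lt_succ _ _).2 (.inr rfl), hmY⟩
          · exact ⟨m', i, rfl, (hN.out.lt_succ _ _).2 (.inl hi), h⟩
        · rintro ⟨m', i, rfl, hi, h⟩
          rcases (hN.out.lt_succ _ _).1 hi with hi | rfl
          · exact .inr ⟨m', i, rfl, hi, h⟩
          · left; rw [huniq i hj m' m h hmY]
      · rcases (hN.out.lt_succ _ _).1 hi with hi | rfl
        exacts [hj i hi, ⟨m, hmY⟩]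
  choose G hG using fun p => (key (N.add p N.one)).2 p ((hN.out.lt_succ _ _).2 (.inr rfl))
  have hYG : ∀ m p, N.pair m p ∈ Y ↔ m = G p := fun m p =>
    ⟨fun h => huniq p (key p).2 _ _ h (hG p), by rintro rfl; exact hG p⟩
  have hres : ∀ j s, N.Restriction S G j s ↔ ∀ x, N.InList S x s ↔ x ∈ N.upTo Y j := by
    intro j s
    refine forall_congr' fun x => iff_congr Iff.rfl ?_
    constructor
    · rintro ⟨i, hi, rfl⟩
      exact ⟨_, i, rfl, hi, hG i⟩
    · rintro ⟨m, i, rfl, hi, h⟩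
      exact ⟨i, hi, by rw [(hYG m i).1 h]⟩
  refine ⟨G, @FunIn.of_tdef _ _ _ ⟨(inferInstance : N.Adef N.sets fun _ ν =>
    N.pair (ν 0) (ν 1) ∈ Y).congr fun _ _ => (hYG _ _).symm⟩, fun j => ?_, fun j s m hs hm hlt => ?_⟩
  · obtain ⟨s, hsK, hs⟩ := (key j).1
    exact ⟨s, hsK, (hres j s).2 hs⟩
  · obtain ⟨s', hs', -, h'⟩ := (hrec j (key j).2 (G j)).1 (hG j)
    exact h' m hlt (hext' _ _ _ (fun x => ((hres j s).1 hs x).trans (hs' x).symm) hm)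

end Model

/-! ### The leftmost path yields a coded β-model -/

namespace Model

variable {N : Model.{u}} {X S : Set N.Num}

/-- The code of a list of instructions. -/
def progCode (N : Model.{u}) : List (Instr N) → N.Num
  | [] => N.zero
  | I :: L => N.cons (N.instrCode (N.numeral I.tag) I.p I.l₁ I.l₂ I.l₃ I.j) (progCode N L)

/-- The parameter functions given by a sequence of functions: the functions in slot zero. -/
def slotZero (G : N.Num → N.Num) (j z : N.Num) : N.Num := G (N.pos j N.zero z)

theorem Codes.inList_progCode (hC : N.Codes X S) (L : List (Instr N)) (x : N.Num) :
    N.InList S x (N.progCode L) ↔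
      ∃ I ∈ L, x = N.instrCode (N.numeral I.tag) I.p I.l₁ I.l₂ I.l₃ I.j := by
  induction L with
  | nil => simpa [progCode] using hC.nil x
  | cons I L ih => rw [progCode, hC.cons, ih]; simp

theorem extending_ext {s s' : N.Num}
    (h : ∀ x, N.InList S x s ↔ N.InList S x s')
    (hs : s ∈ {s | ∃ Y ∈ N.sets, N.Extends S Y s}) :
    s' ∈ {s | ∃ Y ∈ N.sets, N.Extends S Y s} := by
  obtain ⟨Y, hY, h1, h2, h3⟩ := hs
  exact ⟨Y, hY, h1, fun x hx => h2 x ((h x).2 hx), h3⟩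

/-- The accepted function that extends `s` already has a value at `j`, and it also extends the
longer condition. -/
theorem Codes.cons_extending (hC : N.Codes X S) {s : N.Num}
    (hs : s ∈ {s | ∃ Y ∈ N.sets, N.Extends S Y s}) (j : N.Num) :
    ∃ m, N.cons (N.pair m j) s ∈ {s | ∃ Y ∈ N.sets, N.Extends S Y s} := by
  obtain ⟨Y, hY, h1, h2, h3⟩ := hs
  obtain ⟨m, hm, -⟩ := h1 j
  refine ⟨m, Y, hY, h1, fun x hx => ?_, h3⟩
  rcases (hC.cons _ _ _).1 hx with rfl | hx
  exacts [hm, h2 x hx]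

variable [hN : Fact N.ModelsACA₀]

/-- Shows that the clause `j < n` in `Accepts` excludes no instruction of an actual program. -/
theorem lt_progCode {L : List (Instr N)} {I : Instr N} (hI : I ∈ L) :
    N.lt I.j (N.progCode L) := by
  induction L with
  | nil => simp at hI
  | cons I' L ih =>
    rcases List.mem_cons.1 hI with rfl | hI
    · refine lt_of_le_of_lt (b := N.instrCode (N.numeral I.tag) I.p I.l₁ I.l₂ I.l₃ I.j) ?_
        (left_lt_cons _ _)
      have h := fun a b : N.Num => right_le_pair a b
      exact (h _ _).trans ((h _ _).trans ((h _ _).trans ((h _ _).trans (h _ _))))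
    · exact num_lt_trans (ih hI) (right_lt_cons _ _)

theorem pair_one_ne_zero (x : N.Num) : N.pair N.one x ≠ N.zero := fun h => by
  have h1 : N.one ≤ N.zero := h ▸ left_le_pair N.one x
  have h2 := num_zero_lt_succ N.zero
  rw [num_zero_add] at h2
  exact absurd h2 (not_lt.2 h1)

/-- The constant function one has no flag equal to zero and is therefore accepted. -/
theorem Codes.nil_extending (hC : N.Codes X S) :
    N.zero ∈ {s | ∃ Y ∈ N.sets, N.Extends S Y s} := by
  have hf : FunIn (fun _ : N.Num => N.one) := @FunIn.of_tdef _ _ _ Tdef.one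
  refine ⟨_, hf.out, extends_graph_iff.2 ⟨fun x hx => (hC.nil x hx).elim, fun n hn => ?_⟩⟩
  exact (succ_ne_zero N.zero ((num_zero_add _).trans hn)).elim

/-- Acceptance is a closed condition. -/
theorem accepts_of_restrictions {G : N.Num → N.Num}
    (h : ∀ j, ∃ s ∈ {s | ∃ Y ∈ N.sets, N.Extends S Y s}, N.Restriction S G j s) :
    N.Accepts S G := by
  intro n hn t p l₁ l₂ l₃ j hl hj u v w z
  -- An instance of acceptance inspects only the flag and four values. A restriction reaching past
  -- these five positions extends to an accepted function, which agrees with `G` there.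
  let b := max (N.pair n N.zero) (max (N.pos n l₁ u) (max (N.pos n l₂ v)
    (max (N.pos n l₃ w) (N.pos j N.zero z))))
  obtain ⟨s, ⟨Y, -, hY⟩, hs⟩ := h (N.add b N.one)
  obtain ⟨G', hG', -, hr⟩ := hY.exists_fun
  have he : ∀ q, q ≤ b → G q = G' q := fun q hq =>
    hr _ _ ((hs _).2 ⟨q, (num_lt_succ_iff _ _).2 hq, rfl⟩)
  rw [he (N.pair n N.zero) (by simp [b])] at hn
  rw [he (N.pos n l₁ u) (by simp [b]), he (N.pos n l₂ v) (by simp [b]),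
    he (N.pos n l₃ w) (by simp [b]), he (N.pos j N.zero z) (by simp [b])]
  exact hG' n hn t p l₁ l₂ l₃ j hl hj u v w z

/-- Numbers that are not pairs count as having index zero, whence the condition `n ≠ 0`. -/
theorem fst_lt_of_lt {n q : N.Num} (hn : n ≠ N.zero) (hq : N.lt q (N.pair n N.zero)) :
    N.lt (fst q) n := by
  by_cases h : ∃ x y, q = N.pair x y
  · obtain ⟨x, y, rfl⟩ := h
    rw [fst_pair]; exact lt_of_pair_lt_pair_zero hq
  · rw [fst_of_not_pair h]
    obtain ⟨m, rfl⟩ := (zero_or_succ n).resolve_left hn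
    exact num_zero_lt_succ m

/-- Every program that is solvable is solved by the leftmost path. -/
theorem Codes.holds_of_solvable (hC : N.Codes X S) {G : N.Num → N.Num} [hG : FunIn G]
    (hacc : N.Accepts S G)
    (hres : ∀ j, ∃ s ∈ {s | ∃ Y ∈ N.sets, N.Extends S Y s}, N.Restriction S G j s)
    (hleast : ∀ j s m, N.Restriction S G j s →
      N.cons (N.pair m j) s ∈ {s | ∃ Y ∈ N.sets, N.Extends S Y s} → ¬ N.lt m (G j))
    {L : List (Instr N)} {g : N.Num → N.Num} [hg : FunIn g]
    (hL : ∀ I ∈ L, I.Holds X (slotZero G) g) :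
    ∀ I ∈ L, I.Holds X (slotZero G)
      (fun x => G (N.pair (N.progCode L) (N.pair N.one x))) := by
  classical
  rcases eq_or_ne L [] with rfl | hne
  · simp
  set n := N.progCode L with hn
  have hn0 : n ≠ N.zero := by
    obtain ⟨I, L', rfl⟩ := List.exists_cons_of_ne_nil hne
    exact cons_ne_zero _ _
  have hH : FunIn (fun x => if x = N.zero then N.zero else g (snd x)) := by
    have h1 : FunIn (fun _ : N.Num => N.zero) := @FunIn.of_tdef _ _ _ Tdef.zero
    have h2 : FunIn (fun x => g (snd x)) := FunIn.of_tdef _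
    exact FunIn.ite (fun x => x = N.zero) (fun _ => N.zero) (fun x => g (snd x))
  -- The data at index `n`: flag zero at place zero, and the solution `g` at the places `(1, x)`,
  -- which are never zero.
  set H : N.Num → N.Num := fun x => if x = N.zero then N.zero else g (snd x) with hHdef
  have hG₁ : FunIn (fun q => if fst q = n then H (snd q) else N.one) := by
    have h1 : FunIn (fun _ : N.Num => N.one) := @FunIn.of_tdef _ _ _ Tdef.one
    have h2 : FunIn (fun q => H (snd q)) := FunIn.of_tdef _
    exact FunIn.ite (fun q => fst q = n) (fun q => H (snd q)) (fun _ => N.one)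
  have hG₂ := FunIn.ite (fun q => N.lt (fst q) n) G
    (fun q => if fst q = n then H (snd q) else N.one)
  -- The competitor of `G`: the same below index `n`, the solution at `n`, and flags equal to one
  -- above, so that later programs impose nothing.
  set G' : N.Num → N.Num := fun q => if N.lt (fst q) n then G q else
    if fst q = n then H (snd q) else N.one with hG'
  have hlt : ∀ k x, N.lt k n → G' (N.pair k x) = G (N.pair k x) := fun k x hk => by
    simp only [hG', fst_pair, if_pos hk]
  have heq : ∀ x, G' (N.pair n x) = H x := fun x => by
    simp only [hG', fst_pair, snd_pair, if_neg (num_lt_irrefl n), if_true]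
  have hH0 : H N.zero = N.zero := if_pos rfl
  have hH1 : ∀ x, H (N.pair N.one x) = g x := fun x => by
    simp only [hHdef, if_neg (pair_one_ne_zero x), snd_pair]
  have hacc' : N.Accepts S G' := by
    intro k hk t p l₁ l₂ l₃ j hl hj u v w z
    rcases num_lt_trichotomy k n with hkn | rfl | hkn
    -- Since `j < k < n`, an earlier program never looks at the part that was changed.
    · simp only [pos, hlt k _ hkn, hlt j _ (num_lt_trans hj hkn)] at hk ⊢
      exact hacc k hk t p l₁ l₂ l₃ j hl hj u v w z
    · obtain ⟨I, hI, he⟩ := (hC.inList_progCode L _).1 hl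
      simp only [instrCode, pair_inj] at he
      obtain ⟨rfl, rfl, rfl, rfl, rfl, rfl⟩ := he
      simp only [pos, heq, hlt I.j _ hj, hH1]
      exact (hC.table I.tag _ _ _ _ _ _ _ _ _).2 (hL I hI u v w z)
    · simp only [hG', fst_pair, if_neg (show ¬ N.lt k n from lt_asymm (show n < k from hkn)),
        if_neg (show k ≠ n from (show n < k from hkn).ne')] at hk
      exact (succ_ne_zero N.zero ((num_zero_add _).trans hk)).elim
  have hflag : G (N.pair n N.zero) = N.zero := by
    obtain ⟨s, -, hs⟩ := hres (N.pair n N.zero)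
    have hmem : N.cons (N.pair N.zero (N.pair n N.zero)) s ∈
        {s | ∃ Y ∈ N.sets, N.Extends S Y s} := by
      refine ⟨_, hG₂.out, extends_graph_iff.2 ⟨fun x hx => ?_, hacc'⟩⟩
      rcases (hC.cons _ _ _).1 hx with rfl | hx
      · exact ⟨N.pair n N.zero, by rw [heq, hH0]⟩
      · obtain ⟨i, hi, rfl⟩ := (hs x).1 hx
        have he : G' i = G i := if_pos (fst_lt_of_lt hn0 hi)
        exact ⟨i, by rw [he]⟩
    -- The competitor shows that value zero is admissible at position `(n, 0)`, so the least value
    -- there is zero.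
    have := hleast _ s N.zero hs hmem
    rcases zero_or_succ (G (N.pair n N.zero)) with h | ⟨m, h⟩
    · exact h
    · exact (this (h ▸ num_zero_lt_succ m)).elim
  intro I hI u v w z
  exact (hC.table I.tag _ _ _ _ _ _ _ _ _).1 (hacc n hflag _ _ _ _ _ _
    ((hC.inList_progCode L _).2 ⟨I, hI, rfl⟩) (lt_progCode hI) u v w z)

/-- The entries of the table with tag 11 and value zero determine `X`. -/
theorem Codes.param_mem (hC : N.Codes X S) (hS : S ∈ N.sets) : X ∈ N.sets := by
  have : Param N.sets S := ⟨hS⟩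
  convert setOf_mem (fun u => N.pair (N.tuple (N.numeral (11 : Fin 13)) N.zero u N.zero N.zero
    N.zero N.zero N.zero N.zero N.zero) N.zero ∈ S) using 1
  ext u
  exact ((hC.table 11 N.zero u N.zero N.zero N.zero N.zero N.zero N.zero N.zero).trans
    (eq_comm.trans tv_eq_zero_iff)).symm

/-- If a model of `ATR₀` satisfies `Π¹₁`-comprehension for formulas with a suitable parameter `S`, then
it contains a coded `β`-model. -/
theorem Codes.exists_isCodedBeta (hC : N.Codes X S) (hA : N.ModelsATR₀) (hS : S ∈ N.sets)
    (hPi : N.ModelsPi11CA S) : ∃ W, N.IsCodedBeta W ∧ X ∈ (N.coded W).sets := by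
  obtain ⟨G, hG, hres, hleast⟩ := hA.exists_leftmost hS hC.nil hC.cons
    (exists_extending_mem hPi) (fun s s' => extending_ext) hC.nil_extending
    (fun s hs => hC.cons_extending hs)
  have hacc := accepts_of_restrictions hres
  have hsolve := fun (L : List (Instr N)) (g : N.Num → N.Num) (hg : FunIn g) =>
    hC.holds_of_solvable (g := g) (L := L) hacc hres hleast
  have hslot : ∀ j, FunIn (slotZero G j) := fun j =>
    FunIn.of_tdef fun z => G (N.pos j N.zero z)
  let W : Set N.Num := {t | ∃ m n, t = N.pair m n ∧ G (N.pos n N.zero m) = N.zero}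
  have hW : W ∈ N.sets := setOf_mem fun t => ∃ m n, t = N.pair m n ∧ G (N.pos n N.zero m) = N.zero
  have hsec : ∀ n m, m ∈ N.sec W n ↔ slotZero G n m = N.zero := by
    refine fun n m => ⟨?_, fun h => ⟨m, n, rfl, h⟩⟩
    rintro ⟨m', n', he, h⟩
    obtain ⟨rfl, rfl⟩ := pair_inj.1 he
    exact h
  refine ⟨W, ⟨hW, ?_⟩, ?_⟩
  · rintro _ ⟨Z, θ, hθ, rfl⟩ ν σ hσ
    rw [coded_sat_allSet_iff W hθ]
    -- Only the upward direction needs work: a counterexample `A` solves a program for the negated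
    -- matrix, so `G` solves it too, and its slot zero is a counterexample among the sections of
    -- `W`.
    refine ⟨fun h A hA' => ?_, fun h n => h _ (mem_sets_of_mem_coded hW ⟨n, rfl⟩)⟩
    by_contra hc
    obtain ⟨L, hL, hL'⟩ := exists_program (X := X) hslot (θ := θ.not) hθ Z (σ := σ)
      (fun i => by
        obtain ⟨j, hj⟩ := hσ i
        exact ⟨j, fun m => by rw [← hj, hsec]⟩) ν
    obtain ⟨g, hg, hgs⟩ := hL A hA' hc
    refine hL' _ (FunIn.of_tdef _) (hsolve L g hg hgs) ?_
    convert h (N.progCode L) using 2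
    ext m
    exact (hsec _ m).symm
  · have : Param N.sets X := ⟨hC.param_mem hS⟩
    -- The one-instruction program that makes slot zero the characteristic function of `X`. It is
    -- solved by ignoring the slot and testing the argument.
    have h := hsolve [⟨11, N.zero, N.zero, N.zero, N.zero, N.zero⟩]
      (fun q => N.tv (snd q ∈ X)) (FunIn.of_tdef _) (by
        simp only [List.mem_singleton, forall_eq]
        intro u v w z
        simp only [row, snd_pair])
    simp only [List.mem_singleton, forall_eq] at h
    refine ⟨N.progCode [⟨11, N.zero, N.zero, N.zero, N.zero, N.zero⟩],
      Set.ext fun m => (hsec _ m).trans ?_⟩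
    exact (iff_of_eq (congrArg (· = N.zero) (h m m m m))).trans tv_eq_zero_iff

theorem adef_row [Param N.sets X] (i : Fin 13) : N.Adef N.sets (fun _ ν =>
    N.row X (ν 8) (ν 7) (ν 6) (ν 5) (ν 4) (ν 3) (ν 2) (ν 1) (ν 0) i) := by
  fin_cases i <;> simp only [row] <;> infer_instance

/-- A list membership relation and the table of local relations can be coded into one set. -/
theorem IsListMem.exists_codes {E : Set N.Num} (hE : N.IsListMem E) (hE' : E ∈ N.sets)
    (hX : X ∈ N.sets) : ∃ S ∈ N.sets, N.Codes X S := by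
  have : Param N.sets X := ⟨hX⟩
  have : Param N.sets E := ⟨hE'⟩
  let T : Set N.Num := {s | ∃ i : Fin 13, ∃ p u a v b w c z d,
    s = N.tuple (N.numeral i) p u a v b w c z d ∧ N.row X p u a v b w c z d i}
  have hT : Param N.sets T := by
    refine ⟨@setOf_mem _ _ (fun s => ∃ i : Fin 13, ∃ p u a v b w c z d,
      s = N.tuple (N.numeral i) p u a v b w c z d ∧ N.row X p u a v b w c z d i)
      (Adef.ex_fin fun i => ?_)⟩
    have := adef_row (X := X) i
    infer_instance
  refine ⟨_, setOf_mem (fun t => ∃ x, (t = N.pair x N.zero ∧ x ∈ T) ∨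
    (t = N.pair x N.one ∧ x ∈ E)), ?_⟩
  have h01 : N.zero ≠ N.one := fun h => succ_ne_zero N.zero ((num_zero_add _).trans h.symm)
  have key0 : ∀ x, N.pair x N.zero ∈ {t | ∃ x, (t = N.pair x N.zero ∧ x ∈ T) ∨
      (t = N.pair x N.one ∧ x ∈ E)} ↔ x ∈ T := fun x => by
    simp only [Set.mem_ofPred_eq, pair_inj, h01, and_true, and_false, false_and, or_false,
      exists_eq_left']
  have key1 : ∀ x, N.pair x N.one ∈ {t | ∃ x, (t = N.pair x N.zero ∧ x ∈ T) ∨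
      (t = N.pair x N.one ∧ x ∈ E)} ↔ x ∈ E := fun x => by
    simp only [Set.mem_ofPred_eq, pair_inj, h01.symm, and_true, and_false, false_and, false_or,
      exists_eq_left']
  refine ⟨fun x => ?_, fun x y z => ?_, fun i p u a v b w c z d => ?_⟩
  · rw [InList, key1]; exact hE.nil x
  · rw [InList, InList, key1, key1]; exact hE.cons x y z
  · rw [key0]
    constructor
    · rintro ⟨i', p', u', a', v', b', w', c', z', d', he, h⟩
      simp only [tuple, pair_inj, numeral_inj, Fin.val_inj] at he
      obtain ⟨rfl, rfl, rfl, rfl, rfl, rfl, rfl, rfl, rfl, rfl⟩ := he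
      exact h
    · exact fun h => ⟨i, p, u, a, v, b, w, c, z, d, rfl, h⟩

/-- The hypothesis is used twice: at `X`, merely for a model of `ATR₀` in which list membership can
be defined by recursion, and then at the set `S` built from `X` and this relation. -/
theorem PseudoPi11CA.pseudoBetaReflectionATR (h : N.PseudoPi11CA) :
    N.PseudoBetaReflectionATR := by
  intro X hX
  obtain ⟨W, hW, -, hA, -⟩ := h X hX
  have : Fact (N.coded W).ModelsACA₀ := ⟨hA.toModelsACA₀⟩
  obtain ⟨E, hE, hEL⟩ := hA.exists_isListMem
  have hEL' : N.IsListMem E := ⟨hEL.nil, hEL.cons⟩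
  obtain ⟨S, hS, hC⟩ := hEL'.exists_codes (mem_sets_of_mem_coded hW hE) hX
  obtain ⟨W₁, hW₁, hSW, hA₁, hPi⟩ := h S hS
  have : Fact (N.coded W₁).ModelsACA₀ := ⟨hA₁.toModelsACA₀⟩
  obtain ⟨W₀, hβ, hXW⟩ := (hC.coded W₁).exists_isCodedBeta hA₁ hSW hPi
  exact ⟨W₀, mem_sets_of_mem_coded hW₁ hβ.1, W₁, hW₁, hβ.1, hA₁, hβ, hXW⟩

end Model
end SecondOrderArith

theorem proposition2p1 (M : SecondOrderArith.Model) (hM : M.ModelsACA₀) :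
    M.PseudoPi11CA ↔ M.PseudoBetaReflectionATR := by
  have : Fact M.ModelsACA₀ := ⟨hM⟩
  exact ⟨fun h => h.pseudoBetaReflectionATR, fun h => h.pseudoPi11CA⟩
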